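/- Let $M,L\ge 0$ be integers, let $g_1,\dots,g_M$, $s_1,\dots,s_L$, $x$ be independent indeterminates, and set $\mathbf K=\mathbf Q[g_1,\dots,g_M]$, $\mathbf s=(s_1,\dots,s_L)$, $$G(z)=1+\sum_{k=1}^M g_kz^k,\qquad S(z)=\sum_{k=1}^L k\,s_k z^k .$$ For infinite families $\mathbf t=(t_1,t_2,\dots)$ and $\mathbf u=(u_1,u_2,\dots)$ of indeterminates, consider the hypergeometric $\tau$-function $$\tau(\mathbf t,\mathbf u)=\sum_{\lambda}\gamma^{|\lambda|}\Big(\prod_{(i,j)\in\lambda}G\big((j-i)\beta\big)\Big)s_\lambda(\mathbf t)\,s_\lambda(\mathbf u)\in\mathbf K[\mathbf t,\mathbf u,\beta][[\gamma]],$$ where the sum is over all integer partitions and $s_\lambda(\mathbf t)$ is the Schur function written as a polynomial in the scaled power sums $t_i=p_i/i$, that is, $s_\lambda=\det\big(h_{\lambda_i-i+j}\big)$ with $\sum_{n\ge0} h_n(\mathbf t)z^n=\exp\big(\sum_{i\ge1}t_iz^i\big)$ and $h_n=0$ for $n<0$. The connected weighted Hurwitz numbers $\tilde H^d_G(\mu,\nu)\in\mathbf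 K$ are the coefficients in $$\ln\tau(\mathbf t,\mathbf u)=\sum_{|\mu|=|\nu|}\gamma^{|\mu|}\sum_{d\ge0}\beta^d\,\tilde H^d_G(\mu,\nu)\,p_\mu(\mathbf t)\,p_\nu(\mathbf u),\qquad p_\mu(\mathbf t)=\prod_i\mu_it_{\mu_i},\quad p_\nu(\mathbf u)=\prod_i\nu_iu_{\nu_i}.$$ Put $$\tilde F_{0,1}(x)=\sum_{N\ge1}\gamma^Nx^N\sum_{\nu\vdash N}\tilde H_G^{\ell(\nu)-1}\big((N),\nu\big)\,p_\nu(\mathbf s),\qquad y(x)=\tilde W_{0,1}(x)=\frac{\partial}{\partial x}\tilde F_{0,1}(x)\in\mathbf K[x,\mathbf s][[\gamma]],$$ where $s_k=0$ for $k>L$. Then $y(x)$ belongs to $\gamma\mathbf K[x,\mathbf s][[\gamma]]$ and satisfies the classical spectral curve equation $$x\,y(x)=S\big(\gamma x\,G(x\,y(x))\big),$$ and it is the only element of $\gamma\mathbf K[x,\mathbf s][[\gamma]]$ that satisfies it. -/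

import Mathlib

open scoped Polynomial PowerSeries

noncomputable section

namespace SpectralCurve

/-- The coefficient ring `𝐊 = ℚ[g₁, …, g_M]`; the variable `g_{k+1}` is `X k` for `k : Fin M`. -/
abbrev CoeffRing (M : ℕ) : Type := MvPolynomial (Fin M) ℚ

/-- The weight generating polynomial `G(z) = 1 + ∑_{k=1}^M g_k z^k`. -/
def weightG (M : ℕ) : (CoeffRing M)[X] :=
  1 + ∑ k : Fin M, Polynomial.C (MvPolynomial.X k) * Polynomial.X ^ ((k : ℕ) + 1)

/-- The complete symmetric function `h_n` written in the scaled power sums `t_i = p_i / i`,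
i.e. the coefficient of `z^n` in `exp (∑_{i ≥ 1} t_i z^i)`:
`h_n(𝐭) = ∑_{μ ⊢ n} ∏_i t_i^{m_i(μ)} / m_i(μ)!`, and `h_n = 0` for `n < 0`.
The variables are `t_i = X i`; the variable `X 0` never occurs. -/
def hPoly (R : Type*) [CommRing R] [Algebra ℚ R] (n : ℤ) : MvPolynomial ℕ R :=
  if n < 0 then 0 else
    ∑ μ : Nat.Partition n.toNat,
      MvPolynomial.monomial (Multiset.toFinsupp μ.parts)
        (algebraMap ℚ R (∏ i ∈ μ.parts.toFinset, ((μ.parts.count i).factorial : ℚ))⁻¹)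

/-- The `i`-th row length of a partition (rows indexed from `0`, in weakly decreasing order;
`0` beyond the last row). -/
def rowLen {N : ℕ} (lam : Nat.Partition N) (i : ℕ) : ℕ :=
  (lam.parts.sort (· ≥ ·)).getD i 0

/-- The Schur function `s_λ = det (h_{λ_i - i + j})` (Jacobi–Trudi), as a polynomial in the scaled
power sums. -/
def schur (R : Type*) [CommRing R] [Algebra ℚ R] {N : ℕ} (lam : Nat.Partition N) :
    MvPolynomial ℕ R :=
  Matrix.det (Matrix.of fun i j : Fin lam.parts.card =>
    hPoly R ((rowLen lam i : ℤ) - (i : ℤ) + (j : ℤ)))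

/-- The content product `r_λ = ∏_{(i,j) ∈ λ} G((j - i) β)` in `𝐊[β]`
(here `Polynomial.X` is `β`). -/
def contentProduct (M : ℕ) {N : ℕ} (lam : Nat.Partition N) : (CoeffRing M)[X] :=
  ∏ i ∈ Finset.range lam.parts.card, ∏ j ∈ Finset.range (rowLen lam i),
    (weightG M).comp ((((j : ℤ) - (i : ℤ) : ℤ) : (CoeffRing M)[X]) * Polynomial.X)

/-- The ring `𝐊[β][𝐭, 𝐬]` with two infinite families of variables: `t_i = X (Sum.inl i)` and
`s_i = X (Sum.inr i)`. -/
abbrev TauCoeffRing (M : ℕ) : Type := MvPolynomial (ℕ ⊕ ℕ) (CoeffRing M)[X]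

/-- The hypergeometric 2D Toda tau function
`τ(𝐭, 𝐬) = ∑_λ γ^{|λ|} r_λ s_λ(𝐭) s_λ(𝐬)`, a power series in `γ` over `𝐊[β][𝐭, 𝐬]`. -/
def tau (M : ℕ) : (TauCoeffRing M)⟦X⟧ :=
  PowerSeries.mk fun N => ∑ lam : Nat.Partition N,
    MvPolynomial.C (contentProduct M lam) *
      MvPolynomial.rename Sum.inl (schur (CoeffRing M)[X] lam) *
      MvPolynomial.rename Sum.inr (schur (CoeffRing M)[X] lam)

/-- The connected weighted Hurwitz number `H̃^d_G(μ, ν)`: the coefficient of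
`γ^N β^d p_μ(𝐭) p_ν(𝐬)` in `ln τ(𝐭, 𝐬)`, where `p_μ(𝐭) = ∏ μ_i t_{μ_i}` and
`p_ν(𝐬) = ∏ ν_i s_{ν_i}`. -/
def connectedHurwitz (M d : ℕ) {N : ℕ} (μ ν : Nat.Partition N) : CoeffRing M :=
  ((μ.parts.prod : ℚ) * (ν.parts.prod : ℚ))⁻¹ •
    (MvPolynomial.coeff
      (Finsupp.sumElim (Multiset.toFinsupp μ.parts) (Multiset.toFinsupp ν.parts))
      (PowerSeries.coeff N (PowerSeries.logOf (tau M)))).coeff d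

/-- The ring `𝐊[x, 𝐬] = 𝐊[𝐬][x]` with `𝐬 = (s_1, …, s_L)`; the variable `s_{k+1}` is `X k`
for `k : Fin L`. -/
abbrev CurveRing (M L : ℕ) : Type := (MvPolynomial (Fin L) (CoeffRing M))[X]

/-- The parameter `s_k`, which is a variable for `1 ≤ k ≤ L` and `0` otherwise. -/
def sVar (M L k : ℕ) : MvPolynomial (Fin L) (CoeffRing M) :=
  if h : 1 ≤ k ∧ k ≤ L then MvPolynomial.X ⟨k - 1, by omega⟩ else 0

/-- The polynomial `S(z) = ∑_{k=1}^L k s_k z^k`. -/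
def polyS (M L : ℕ) : (MvPolynomial (Fin L) (CoeffRing M))[X] :=
  ∑ k ∈ Finset.Icc 1 L, Polynomial.C ((k : MvPolynomial (Fin L) (CoeffRing M)) * sVar M L k) *
    Polynomial.X ^ k

/-- `p_ν(𝐬) = ∏ ν_i s_{ν_i}`. -/
def powerSumS (M L : ℕ) {N : ℕ} (ν : Nat.Partition N) : MvPolynomial (Fin L) (CoeffRing M) :=
  (ν.parts.map fun k : ℕ => (k : MvPolynomial (Fin L) (CoeffRing M)) * sVar M L k).prod

/-- `F̃_{0,1}(𝐬; γ; x) = ∑_{|μ| = |ν|, ℓ(μ) = 1} γ^{|μ|} H̃_G^{ℓ(ν) - 1}(μ, ν) |aut μ| m_μ(x) p_ν(𝐬)`.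
The partitions `μ` with one part are `μ = (N)`, `N ≥ 1`, for which `|aut μ| m_μ(x) = x^N`. -/
def F01 (M L : ℕ) : (CurveRing M L)⟦X⟧ :=
  PowerSeries.mk fun N => if N = 0 then 0 else
    ∑ ν : Nat.Partition N,
      Polynomial.C (MvPolynomial.C
          (connectedHurwitz M (ν.parts.card - 1) (Nat.Partition.indiscrete N) ν) *
        powerSumS M L ν) * Polynomial.X ^ N

/-- `W̃_{0,1}(𝐬; γ; x) = ∂/∂x F̃_{0,1}(𝐬; γ; x)`. -/
def W01 (M L : ℕ) : (CurveRing M L)⟦X⟧ :=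
  PowerSeries.mk fun N => Polynomial.derivative (PowerSeries.coeff N (F01 M L))

/-- The indeterminate `x`, as an element of `𝐊[x, 𝐬][[γ]]`. -/
def xVar (M L : ℕ) : (CurveRing M L)⟦X⟧ := PowerSeries.C (R := CurveRing M L) Polynomial.X

/-- The indeterminate `γ` of `𝐊[x, 𝐬][[γ]]`. -/
def gammaVar (M L : ℕ) : (CurveRing M L)⟦X⟧ := PowerSeries.X

/-- The spectral curve equation `x y = S(γ x G(x y))` for `y ∈ 𝐊[x, 𝐬][[γ]]`. -/
def IsSpectralCurveSolution (M L : ℕ) (y : (CurveRing M L)⟦X⟧) : Prop :=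
  xVar M L * y =
    Polynomial.aeval
      (gammaVar M L * xVar M L * Polynomial.aeval (xVar M L * y) (weightG M)) (polyS M L)

end SpectralCurve

end

/-! Both sides are compared with Lagrange inversion. Let `H(z) = ∑ h_n z^n`, `P(z) = ∑ i t_i z^i`
and `θ = z d/dz`.

Only terms linear in `t_N` matter for `μ = (N)`. Since `τ = 1` at `𝐭 = 0`, the logarithm does not
change them (`coeff_logOf`), and the coefficient of `t_N` in `s_λ` is `(-1)^b` for the hook `(N - b,
1^b)` and `0` for every other `λ`. So the one-part numbers are sums over `b < N` of the content
product of the hook times `(-1)^b s_{(N-b, 1^b)}(𝐮)`.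

The `β^k` coefficient of that content product is a polynomial in `b` of degree at most `k`, with
leading coefficient `(-1)^k [z^k] G^N`. The signed hook Schur functions are partial sums of the
coefficient of `z^N` in `H · H⁻¹ = 1`. Summing them against `b^m` by parts gives combinations of
`[z^N] H θ^j H⁻¹` with `j ≤ m + 1`. As `θ H = P H`, one has `H θ^j H⁻¹ = (θ - P)^j 1`, of degree at
most `j` in the variables with top part `(-P)^j`. The genus zero condition `ℓ(ν) = k + 1` therefore
selects only the leading power `m = k` (`coeff_sum_pow_mul_hookSum`).

After `P` is specialised to `S`, the coefficient of `(γ x)^N` in `x y` is `∑_k (k+1)⁻¹ [z^k] G^N ·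
[z^N] S^{k+1}`. By Lagrange inversion (`exists_fixedPoint_coeff`) these are the coefficients of the
solution of `u = S(z G(u))`, and `z = γ x` gives the curve. Uniqueness holds because the equation is
a contraction in the `γ`-adic topology. -/

noncomputable section

namespace SpectralCurve

/-! ### Lagrange inversion for `u = S(X G(u))` -/

section Lagrange

open PowerSeries

variable {R : Type*} [CommRing R]

/-- The equation `u = S(f G(u))` has at most one solution when `X ∣ f`. -/
theorem fixedPoint_unique (S G : R⟦X⟧[X]) {f u v : R⟦X⟧} (hf : (X : R⟦X⟧) ∣ f)
    (hu : u = S.eval (f * G.eval u)) (hv : v = S.eval (f * G.eval v)) : u = v := by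
  obtain ⟨g, rfl⟩ := hf
  obtain ⟨p, hp⟩ := Polynomial.sub_dvd_eval_sub (X * g * G.eval u) (X * g * G.eval v) S
  obtain ⟨q, hq⟩ := Polynomial.sub_dvd_eval_sub u v G
  -- A difference of polynomial values is divisible by the difference of the arguments. Applied to
  -- `S` and then to `G`, this makes `u - v` a multiple of `X * (u - v)`.
  have h : (1 - X * (g * q * p)) * (u - v) = 0 := by
    have h1 : u - v = X * g * ((u - v) * q) * p := by
      rw [← hq, mul_sub, ← hp, ← hu, ← hv]
    linear_combination h1
  have hunit : IsUnit (1 - X * (g * q * p) : R⟦X⟧) := by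
    rw [PowerSeries.isUnit_iff_constantCoeff]
    simp
  exact sub_eq_zero.mp (hunit.mul_right_eq_zero.mp h)

/-- If `f φ = X` and `φ` has constant coefficient `1`, then extracting the coefficient of `X ^ n`
from `f ^ k f' φ ^ (n + 1)` is the same as extracting the residue of `f ^ (k - n - 1) f'`. -/
theorem coeff_pow_mul_derivative_mul_pow [IsDomain R] [CharZero R] {f φ : R⟦X⟧}
    (hf : f * φ = X) (hf0 : constantCoeff f = 0) (n k : ℕ) (hk : k ≤ n) :
    coeff n (f ^ k * (d⁄dX R f * φ ^ (n + 1))) = if k = n then 1 else 0 := by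
  obtain ⟨j, rfl⟩ := Nat.exists_eq_add_of_le hk
  have hd : d⁄dX R f * φ = 1 - f * d⁄dX R φ := by
    have := congrArg (d⁄dX R) hf
    rw [Derivation.leibniz, PowerSeries.derivative_X] at this
    simp only [smul_eq_mul] at this
    linear_combination this
  have h1 : f ^ k * (d⁄dX R f * φ ^ (k + j + 1)) = X ^ k * (φ ^ j * (d⁄dX R f * φ)) := by
    rw [← hf]; ring
  rw [h1, add_comm k j, PowerSeries.coeff_X_pow_mul, hd]
  rcases j with _ | j
  · simp [hf0]
  · have h2 : φ ^ (j + 1) * (1 - f * d⁄dX R φ) = φ ^ (j + 1) - X * (φ ^ j * d⁄dX R φ) := by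
      rw [← hf]; ring
    rw [h2, map_sub, PowerSeries.coeff_succ_X_mul, if_neg (by omega)]
    -- Both sides are coefficients of `(φ ^ (j + 1))'`; this is the vanishing of the residue of an
    -- exact differential.
    have h3 : ((j + 1 : ℕ) : R) * coeff j (φ ^ j * d⁄dX R φ) =
        ((j + 1 : ℕ) : R) * coeff (j + 1) (φ ^ (j + 1)) := by
      have h4 := PowerSeries.coeff_derivative (φ ^ (j + 1)) j
      rw [PowerSeries.derivative_pow] at h4
      simp only [Nat.add_sub_cancel, mul_assoc] at h4
      rw [show ((j + 1 : ℕ) : R⟦X⟧) = PowerSeries.C ((j + 1 : ℕ) : R) by simp,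
        PowerSeries.coeff_C_mul] at h4
      rw [h4]; push_cast; ring
    have h5 := mul_left_cancel₀ (Nat.cast_ne_zero.mpr (Nat.succ_ne_zero j)) h3
    rw [h5, sub_self]

/-- **Lagrange inversion**, in the form of a residue computation. -/
theorem coeff_subst_mul_derivative_mul_pow [IsDomain R] [CharZero R] {f φ : R⟦X⟧}
    (hf : f * φ = X) (hf0 : constantCoeff f = 0) (v : R⟦X⟧) (n : ℕ) :
    coeff n (v.subst f * (d⁄dX R f * φ ^ (n + 1))) = coeff n v := by
  have hs : HasSubst f := HasSubst.of_constantCoeff_zero' hf0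
  -- The tail of `v` contributes a multiple of `f ^ (n + 1)`, hence of `X ^ (n + 1)`, so only
  -- finitely many powers of `f` have to be treated.
  have hv : v = ((v.trunc (n + 1) : R[X]) : R⟦X⟧) +
      X ^ (n + 1) * mk fun i => coeff (n + 1 + i) v := by
    ext i
    rw [map_add, Polynomial.coeff_coe, PowerSeries.coeff_trunc, PowerSeries.coeff_X_pow_mul']
    split_ifs with h1 h2 h2
    · omega
    · simp
    · rw [PowerSeries.coeff_mk, zero_add, Nat.add_sub_cancel' h2]
    · omega
  have h0 : coeff n ((X ^ (n + 1) * mk fun i => coeff (n + 1 + i) v).subst f *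
      (d⁄dX R f * φ ^ (n + 1))) = 0 := by
    rw [PowerSeries.subst_mul hs, PowerSeries.subst_pow hs, PowerSeries.subst_X hs, mul_assoc]
    have hdvd : (X : R⟦X⟧) ∣ f := PowerSeries.X_dvd_iff.mpr hf0
    exact PowerSeries.X_pow_dvd_iff.mp (Dvd.dvd.mul_right (pow_dvd_pow_of_dvd hdvd (n + 1)) _) n
      (Nat.lt_succ_self n)
  conv_lhs => rw [hv, PowerSeries.subst_add hs, add_mul, map_add, h0, add_zero,
    PowerSeries.subst_coe hs, Polynomial.aeval_eq_sum_range' (PowerSeries.natDegree_trunc_lt v n),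
    Finset.sum_mul, map_sum]
  rw [Finset.sum_eq_single n]
  · rw [PowerSeries.smul_eq_C_mul, mul_assoc, PowerSeries.coeff_C_mul,
      coeff_pow_mul_derivative_mul_pow hf hf0 n n le_rfl]
    simp [PowerSeries.coeff_trunc]
  · intro k hk hkn
    rw [PowerSeries.smul_eq_C_mul, mul_assoc, PowerSeries.coeff_C_mul,
      coeff_pow_mul_derivative_mul_pow hf hf0 n k (by simpa [Nat.lt_succ_iff] using hk), if_neg hkn,
      mul_zero]
  · simp

/-- The solution of `u = S(X G(u))` exists and its coefficients are given by Lagrange inversion. -/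
theorem exists_fixedPoint [IsDomain R] [CharZero R] (S G : R[X]) (hS : S.coeff 0 = 0)
    (hG : G.coeff 0 = 1) :
    ∃ u : R⟦X⟧, u = Polynomial.aeval (X * Polynomial.aeval u G) S ∧ constantCoeff u = 0 ∧
      ∀ n, ((n + 1 : ℕ) : R) * coeff (n + 1) u =
        coeff n (d⁄dX R (S : R⟦X⟧) * Polynomial.aeval (S : R⟦X⟧) (G ^ (n + 1))) := by
  have hS0 : constantCoeff (S : R⟦X⟧) = 0 := by
    rw [← PowerSeries.coeff_zero_eq_constantCoeff_apply, Polynomial.coeff_coe, hS]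
  have hsS : HasSubst (S : R⟦X⟧) := HasSubst.of_constantCoeff_zero' hS0
  set φ : R⟦X⟧ := Polynomial.aeval (S : R⟦X⟧) G with hφ
  have hφ0 : constantCoeff φ = 1 := by
    have h : (constantCoeff : R⟦X⟧ →+* R) (G.eval₂ (algebraMap R R⟦X⟧) S) = 1 := by
      rw [Polynomial.hom_eval₂, hS0, Polynomial.eval₂_at_zero, hG, map_one]
    exact h
  have hφu : IsUnit φ := by
    rw [PowerSeries.isUnit_iff_constantCoeff, hφ0]; exact isUnit_one
  obtain ⟨ψ, hψ⟩ := hφu.exists_right_inv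
  -- `f = X / G(S(X))` is the compositional inverse of the sought `g = X G(u)`, where `u = S(g)`.
  set f : R⟦X⟧ := X * ψ with hfdef
  have hf : f * φ = X := by rw [hfdef, mul_assoc, mul_comm ψ, hψ, mul_one]
  have hf0 : constantCoeff f = 0 := by simp [hfdef]
  have hf1 : IsUnit (coeff 1 f) := by
    have h := congrArg constantCoeff hψ
    rw [map_mul, hφ0, one_mul, map_one] at h
    rw [hfdef, show (1 : ℕ) = 0 + 1 from rfl, PowerSeries.coeff_succ_X_mul,
      PowerSeries.coeff_zero_eq_constantCoeff_apply, h]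
    exact isUnit_one
  have hsf : HasSubst f := HasSubst.of_constantCoeff_zero' hf0
  obtain ⟨g, hg0, hfg, hgf⟩ : ∃ g : R⟦X⟧, constantCoeff g = 0 ∧ PowerSeries.subst g f = X ∧ PowerSeries.subst f g = X :=
    ⟨_, PowerSeries.constantCoeff_substInvOfIsUnit f hf1,
      PowerSeries.subst_substInvOfIsUnit_right f hf0 hf1,
      PowerSeries.subst_substInvOfIsUnit_left f hf0 hf1⟩
  have hsg : HasSubst g := HasSubst.of_constantCoeff_zero' hg0
  have hu : (S : R⟦X⟧).subst g = Polynomial.aeval g S := PowerSeries.subst_coe hsg S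
  have hφg : PowerSeries.subst g φ = Polynomial.aeval ((S : R⟦X⟧).subst g) G := by
    rw [hφ, ← PowerSeries.coe_substAlgHom hsg, Polynomial.aeval_algHom_apply]
  have hg : X * Polynomial.aeval ((S : R⟦X⟧).subst g) G = g := by
    rw [← hφg, ← hfg, ← PowerSeries.subst_mul hsg, hf, PowerSeries.subst_X hsg]
  refine ⟨(S : R⟦X⟧).subst g, by rw [hg, hu], ?_, fun n => ?_⟩
  · exact PowerSeries.constantCoeff_subst_eq_zero hg0 _ hS0
  have hS' : PowerSeries.subst f (PowerSeries.subst g (S : R⟦X⟧)) = (S : R⟦X⟧) := by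
    rw [PowerSeries.subst_comp_subst_apply hsg hsf, hgf, PowerSeries.X_subst]
  -- Chain rule for `S = u ∘ f`; the residue formula is then applied with `v = u'`.
  have hd : d⁄dX R (S : R⟦X⟧) = PowerSeries.subst f (d⁄dX R (PowerSeries.subst g (S : R⟦X⟧))) * d⁄dX R f := by
    rw [← PowerSeries.derivative_subst hsf, hS']
  rw [hd, map_pow, mul_assoc, coeff_subst_mul_derivative_mul_pow hf hf0,
    PowerSeries.coeff_derivative]
  push_cast
  ring

/-- The coefficients of the solution of `u = S(X G(u))`. -/
theorem exists_fixedPoint_coeff [IsDomain R] [CharZero R] [Algebra ℚ R] (S G : R[X])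
    (hS : S.coeff 0 = 0) (hG : G.coeff 0 = 1) :
    ∃ u : R⟦X⟧, u = Polynomial.aeval (X * Polynomial.aeval u G) S ∧ constantCoeff u = 0 ∧
      ∀ n ≠ 0, coeff n u = ∑ k ∈ Finset.range n,
        algebraMap ℚ R ((k : ℚ) + 1)⁻¹ * (G ^ n).coeff k * coeff n ((S : R⟦X⟧) ^ (k + 1)) := by
  obtain ⟨u, hu, hu0, hc⟩ := exists_fixedPoint S G hS hG
  refine ⟨u, hu, hu0, fun n hn => ?_⟩
  obtain ⟨n, rfl⟩ := Nat.exists_eq_succ_of_ne_zero hn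
  have hS0 : (X : R⟦X⟧) ∣ (S : R⟦X⟧) := by
    rw [PowerSeries.X_dvd_iff, ← PowerSeries.coeff_zero_eq_constantCoeff_apply,
      Polynomial.coeff_coe, hS]
  have hvanish : ∀ k, n < k → coeff n (d⁄dX R (S : R⟦X⟧) * (S : R⟦X⟧) ^ k) = 0 := fun k hk =>
    PowerSeries.X_pow_dvd_iff.mp (Dvd.dvd.mul_left (pow_dvd_pow_of_dvd hS0 k) _) n hk
  have hder : ∀ k : ℕ, ((k : R) + 1) * coeff n (d⁄dX R (S : R⟦X⟧) * (S : R⟦X⟧) ^ k) =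
      ((n + 1 : ℕ) : R) * coeff (n + 1) ((S : R⟦X⟧) ^ (k + 1)) := by
    intro k
    have h4 := PowerSeries.coeff_derivative ((S : R⟦X⟧) ^ (k + 1)) n
    rw [PowerSeries.derivative_pow] at h4
    simp only [Nat.add_sub_cancel, mul_assoc] at h4
    rw [show ((k + 1 : ℕ) : R⟦X⟧) = PowerSeries.C ((k : R) + 1) by simp,
      PowerSeries.coeff_C_mul, mul_comm (_ ^ k)] at h4
    rw [h4]; push_cast; ring
  refine mul_left_cancel₀ (Nat.cast_ne_zero.mpr (Nat.succ_ne_zero n) : ((n + 1 : ℕ) : R) ≠ 0) ?_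
  -- The range is long enough to contain every term of `G ^ (n + 1)`, and is then cut to `n + 1`,
  -- because `S' S ^ k` has no `X ^ n` term for `k > n`.
  rw [Nat.succ_eq_add_one, hc, Polynomial.aeval_eq_sum_range' (n := n + 1 + (G ^ (n + 1)).natDegree)
    (by omega), Finset.mul_sum, map_sum, Finset.mul_sum,
    ← Finset.sum_subset (Finset.range_mono (Nat.le_add_right (n + 1) (G ^ (n + 1)).natDegree))]
  · refine Finset.sum_congr rfl fun k _ => ?_
    have hk : algebraMap ℚ R ((k : ℚ) + 1)⁻¹ * ((k : R) + 1) = 1 := by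
      have h : ((k : R) + 1) = algebraMap ℚ R ((k : ℚ) + 1) := by simp
      rw [h, ← map_mul, inv_mul_cancel₀ (by positivity), map_one]
    rw [PowerSeries.smul_eq_C_mul, mul_left_comm, PowerSeries.coeff_C_mul]
    linear_combination (-(G ^ (n + 1)).coeff k *
      coeff n (d⁄dX R (S : R⟦X⟧) * (S : R⟦X⟧) ^ k)) * hk +
      algebraMap ℚ R ((k : ℚ) + 1)⁻¹ * (G ^ (n + 1)).coeff k * hder k
  · intro k _ hk
    rw [PowerSeries.smul_eq_C_mul, mul_left_comm, PowerSeries.coeff_C_mul,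
      hvanish k (by simpa using hk), mul_zero]

end Lagrange

/-! ### Complete symmetric functions and power sums of hook Schur functions -/

section SymmetricFunctions

open PowerSeries

theorem weight_toFinsupp (s : Multiset ℕ) :
    Finsupp.weight (id : ℕ → ℕ) (Multiset.toFinsupp s) = s.sum := by
  induction s using Multiset.induction_on with
  | empty => simp
  | cons a s ih =>
    rw [← Multiset.singleton_add, map_add, map_add, ih, Multiset.toFinsupp_singleton,
      Finsupp.weight_single]
    simp

theorem degree_toFinsupp (s : Multiset ℕ) :
    Finsupp.degree (Multiset.toFinsupp s) = s.card := by
  induction s using Multiset.induction_on with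
  | empty => simp
  | cons a s ih =>
    rw [← Multiset.singleton_add, map_add, map_add, ih, Multiset.toFinsupp_singleton,
      Finsupp.degree_single, Multiset.card_add, Multiset.card_singleton]

theorem toFinsupp_parts_apply_zero {n : ℕ} (ν : Nat.Partition n) :
    Multiset.toFinsupp ν.parts 0 = 0 := by
  rw [Multiset.toFinsupp_apply, Multiset.count_eq_zero]
  exact fun h => (ν.parts_pos h).ne' rfl

theorem toFinsupp_parts_injective {n : ℕ} :
    Function.Injective fun ν : Nat.Partition n => Multiset.toFinsupp ν.parts :=
  fun _ _ h => Nat.Partition.ext (Multiset.toFinsupp.injective h)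

/-- The partition with prescribed multiplicities. -/
theorem exists_partition_toFinsupp {n : ℕ} {d : ℕ →₀ ℕ} (h0 : d 0 = 0)
    (hd : Finsupp.weight (id : ℕ → ℕ) d = n) :
    ∃ ν : Nat.Partition n, Multiset.toFinsupp ν.parts = d := by
  refine ⟨⟨Multiset.toFinsupp.symm d, fun {i} hi => ?_, ?_⟩, by simp⟩
  · rcases Nat.eq_zero_or_pos i with rfl | h
    · rw [← Multiset.count_pos, ← Multiset.toFinsupp_apply] at hi
      simp [h0] at hi
    · exact h
  · rw [← weight_toFinsupp, AddEquiv.apply_symm_apply, hd]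

/-- The coefficient `∏ 1 / d_i!` of the monomial `t^d` in a complete symmetric function. -/
def invFactorialProd (d : ℕ →₀ ℕ) : ℚ := d.prod fun _ m => ((m.factorial : ℚ))⁻¹

theorem invFactorialProd_add_single (d : ℕ →₀ ℕ) (i : ℕ) :
    invFactorialProd d = ((d i : ℚ) + 1) * invFactorialProd (d + Finsupp.single i 1) := by
  have he : (d + Finsupp.single i 1).erase i = d.erase i := by
    rw [Finsupp.erase_add, Finsupp.erase_single, add_zero]
  unfold invFactorialProd
  rw [← Finsupp.mul_prod_erase' d i _ (fun _ => by simp),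
    ← Finsupp.mul_prod_erase' (d + Finsupp.single i 1) i _ (fun _ => by simp), he, ← mul_assoc]
  congr 1
  rw [Finsupp.add_apply, Finsupp.single_eq_same, Nat.factorial_succ]
  push_cast
  field_simp

theorem coeff_hPoly (n : ℕ) (d : ℕ →₀ ℕ) :
    MvPolynomial.coeff d (hPoly ℚ n) =
      if d 0 = 0 ∧ Finsupp.weight (id : ℕ → ℕ) d = n then invFactorialProd d else 0 := by
  rw [hPoly, if_neg (by omega)]
  simp only [MvPolynomial.coeff_sum, MvPolynomial.coeff_monomial, Int.toNat_natCast]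
  split_ifs with h
  · obtain ⟨ν, rfl⟩ := exists_partition_toFinsupp h.1 h.2
    rw [Finset.sum_eq_single ν]
    · rw [if_pos rfl, invFactorialProd, Finsupp.prod, Multiset.toFinsupp_support,
        Finset.prod_inv_distrib]
      simp
    · intro μ _ hμ
      exact if_neg fun h' => hμ (toFinsupp_parts_injective h')
    · simp
  · refine Finset.sum_eq_zero fun ν _ => if_neg ?_
    rintro rfl
    exact h ⟨toFinsupp_parts_apply_zero ν, by rw [weight_toFinsupp, ν.parts_sum]⟩

theorem hPoly_zero : hPoly ℚ 0 = 1 := by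
  ext d
  have := coeff_hPoly 0 d
  rw [Nat.cast_zero] at this
  rw [this, MvPolynomial.coeff_one]
  by_cases hd : 0 = d
  · subst hd; simp [invFactorialProd]
  · rw [if_neg hd, if_neg]
    rintro ⟨h0, hw⟩
    apply hd
    ext i
    rcases Nat.eq_zero_or_pos i with rfl | hi
    · simp [h0]
    · by_contra hne
      have := Finsupp.le_weight (id : ℕ → ℕ) (s := i) hi.ne' d
      rw [hw] at this
      simp at hne
      omega

theorem hPoly_of_neg (R : Type*) [CommRing R] [Algebra ℚ R] {n : ℤ} (hn : n < 0) :
    hPoly R n = 0 := if_pos hn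

theorem hPoly_eq_map (R : Type*) [CommRing R] [Algebra ℚ R] (n : ℤ) :
    hPoly R n = MvPolynomial.map (algebraMap ℚ R) (hPoly ℚ n) := by
  unfold hPoly
  split_ifs
  · simp
  · simp [MvPolynomial.map_monomial]

/-- The generating series `H(z) = ∑ h_n z^n`. -/
def hSeries : (MvPolynomial ℕ ℚ)⟦X⟧ := PowerSeries.mk fun n => hPoly ℚ n

/-- The generating series `∑ i t_i z^i` of the power sums. -/
def pSeries : (MvPolynomial ℕ ℚ)⟦X⟧ :=
  PowerSeries.mk fun i => MvPolynomial.C (i : ℚ) * MvPolynomial.X i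

/-- The inverse series `H(z)⁻¹ = ∑ (-1)^n e_n z^n`. -/
def eSeries : (MvPolynomial ℕ ℚ)⟦X⟧ := PowerSeries.invOfUnit hSeries 1

theorem hSeries_mul_eSeries : hSeries * eSeries = 1 := by
  refine PowerSeries.mul_invOfUnit _ _ ?_
  rw [← PowerSeries.coeff_zero_eq_constantCoeff_apply, hSeries, PowerSeries.coeff_mk]
  exact hPoly_zero

theorem coeff_zero_eSeries : coeff 0 eSeries = 1 := by
  have h := congrArg (coeff 0) hSeries_mul_eSeries
  have h0 : coeff 0 hSeries = 1 := by rw [hSeries, PowerSeries.coeff_mk]; exact hPoly_zero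
  rw [PowerSeries.coeff_mul] at h
  simpa [h0] using h

/-- Newton's identity `n h_n = ∑ i t_i h_{n-i}`. -/
theorem newton_hPoly (n : ℕ) :
    MvPolynomial.C (n : ℚ) * hPoly ℚ n =
      ∑ p ∈ Finset.HasAntidiagonal.antidiagonal n, MvPolynomial.C (p.1 : ℚ) * MvPolynomial.X p.1 * hPoly ℚ p.2 := by
  ext d
  rw [MvPolynomial.coeff_C_mul, MvPolynomial.coeff_sum, coeff_hPoly]
  simp only [mul_assoc, MvPolynomial.coeff_C_mul, MvPolynomial.coeff_X_mul', coeff_hPoly]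
  -- At a fixed monomial `t^d`, the `i`-th summand is `i * d i` times the coefficient of `t^d` in
  -- `h_n`. These factors add up to the weight of `d`, which is `n`.
  have hterm : ∀ p ∈ Finset.HasAntidiagonal.antidiagonal n, (p.1 : ℚ) * (if p.1 ∈ d.support then
      if (d - Finsupp.single p.1 1 : ℕ →₀ ℕ) 0 = 0 ∧
        Finsupp.weight (id : ℕ → ℕ) (d - Finsupp.single p.1 1) = p.2
      then invFactorialProd (d - Finsupp.single p.1 1) else 0 else 0) =
      if d 0 = 0 ∧ Finsupp.weight (id : ℕ → ℕ) d = n then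
        ((p.1 * d p.1 : ℕ) : ℚ) * invFactorialProd d else 0 := by
    rintro ⟨i, j⟩ hp
    rw [Finset.HasAntidiagonal.mem_antidiagonal] at hp
    simp only at hp ⊢
    rcases Nat.eq_zero_or_pos i with rfl | hi
    · simp
    by_cases his : i ∈ d.support
    · rw [if_pos his]
      rw [Finsupp.mem_support_iff] at his
      obtain ⟨e, rfl⟩ : ∃ e, d = e + Finsupp.single i 1 :=
        ⟨d - Finsupp.single i 1, (tsub_add_cancel_of_le (by
          rw [Finsupp.single_le_iff]; omega)).symm⟩
      rw [add_tsub_cancel_right, map_add, Finsupp.weight_single, Finsupp.add_apply,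
        Finsupp.single_eq_of_ne (by omega), add_zero, invFactorialProd_add_single e i]
      have : Finsupp.weight (id : ℕ → ℕ) e = j ↔
          Finsupp.weight (id : ℕ → ℕ) e + 1 • id i = n := by
        simp only [id_eq, smul_eq_mul, one_mul]; omega
      simp only [this]
      split_ifs
      · simp; ring
      · simp
    · rw [if_neg his]
      rw [Finsupp.notMem_support_iff] at his
      simp [his]
  rw [Finset.sum_congr rfl hterm]
  split_ifs with h
  · rw [← Finset.sum_mul, ← Nat.cast_sum]
    congr 2
    rw [Finset.Nat.sum_antidiagonal_eq_sum_range_succ_mk]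
    conv_lhs => rw [← h.2]
    rw [Finsupp.weight_apply, Finsupp.sum]
    simp only [smul_eq_mul, id_eq, mul_comm]
    refine Finset.sum_subset (fun i hi => ?_) (fun i _ hi => ?_)
    · have := Finsupp.le_weight_of_ne_zero' (id : ℕ → ℕ) (Finsupp.mem_support_iff.mp hi)
      rw [h.2] at this
      simpa [Nat.lt_succ_iff] using this
    · rw [Finsupp.notMem_support_iff.mp hi, mul_zero]
  · simp

/-- The Euler operator `θ = z d/dz` on power series. -/
def eulerOp (f : (MvPolynomial ℕ ℚ)⟦X⟧) : (MvPolynomial ℕ ℚ)⟦X⟧ := X * d⁄dX _ f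

theorem coeff_eulerOp (f : (MvPolynomial ℕ ℚ)⟦X⟧) (n : ℕ) :
    coeff n (eulerOp f) = MvPolynomial.C (n : ℚ) * coeff n f := by
  rcases n with _ | n
  · simp [eulerOp]
  · rw [eulerOp, PowerSeries.coeff_succ_X_mul, PowerSeries.coeff_derivative, mul_comm]
    simp

theorem eulerOp_mul (f g : (MvPolynomial ℕ ℚ)⟦X⟧) :
    eulerOp (f * g) = f * eulerOp g + eulerOp f * g := by
  simp only [eulerOp, Derivation.leibniz, smul_eq_mul]
  ring

/-- Newton's identities, collected into one differential equation. -/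
theorem eulerOp_hSeries : eulerOp hSeries = pSeries * hSeries := by
  ext1 n
  rw [coeff_eulerOp, PowerSeries.coeff_mul]
  simp only [hSeries, pSeries, PowerSeries.coeff_mk]
  exact newton_hPoly n

theorem coeff_iterate_eulerOp (f : (MvPolynomial ℕ ℚ)⟦X⟧) (m n : ℕ) :
    coeff n (eulerOp^[m] f) = MvPolynomial.C ((n : ℚ) ^ m) * coeff n f := by
  induction m with
  | zero => simp
  | succ m ih =>
    rw [Function.iterate_succ_apply', coeff_eulerOp, ih, ← mul_assoc, ← map_mul, pow_succ']

/-- The series `H θ^m H⁻¹`. -/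
def conjSeries (m : ℕ) : (MvPolynomial ℕ ℚ)⟦X⟧ := hSeries * eulerOp^[m] eSeries

theorem conjSeries_zero : conjSeries 0 = 1 := hSeries_mul_eSeries

/-- Conjugating `θ` by `H` gives `θ - P`, by the product rule and `θ H = P H`. -/
theorem conjSeries_succ (m : ℕ) :
    conjSeries (m + 1) = eulerOp (conjSeries m) - pSeries * conjSeries m := by
  rw [conjSeries, conjSeries, eulerOp_mul, eulerOp_hSeries, Function.iterate_succ_apply']
  ring

/-- The predicate "all coefficients are polynomials of total degree less than `m`". -/
def DegreeLT (m : ℕ) (f : (MvPolynomial ℕ ℚ)⟦X⟧) : Prop :=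
  ∀ n d, m ≤ Finsupp.degree d → MvPolynomial.coeff d (coeff n f) = 0

theorem DegreeLT.add {m : ℕ} {f g : (MvPolynomial ℕ ℚ)⟦X⟧} (hf : DegreeLT m f)
    (hg : DegreeLT m g) : DegreeLT m (f + g) := fun n d hd => by
  rw [map_add, MvPolynomial.coeff_add, hf n d hd, hg n d hd, add_zero]

theorem DegreeLT.neg {m : ℕ} {f : (MvPolynomial ℕ ℚ)⟦X⟧} (hf : DegreeLT m f) :
    DegreeLT m (-f) := fun n d hd => by
  rw [map_neg, MvPolynomial.coeff_neg, hf n d hd, neg_zero]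

theorem DegreeLT.mono {m k : ℕ} {f : (MvPolynomial ℕ ℚ)⟦X⟧} (hf : DegreeLT m f) (h : m ≤ k) :
    DegreeLT k f := fun n d hd => hf n d (h.trans hd)

theorem DegreeLT.eulerOp {m : ℕ} {f : (MvPolynomial ℕ ℚ)⟦X⟧} (hf : DegreeLT m f) :
    DegreeLT m (eulerOp f) := fun n d hd => by
  rw [coeff_eulerOp, MvPolynomial.coeff_C_mul, hf n d hd, mul_zero]

theorem DegreeLT.pSeries_mul {m : ℕ} {f : (MvPolynomial ℕ ℚ)⟦X⟧} (hf : DegreeLT m f) :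
    DegreeLT (m + 1) (pSeries * f) := fun n d hd => by
  rw [PowerSeries.coeff_mul, MvPolynomial.coeff_sum]
  refine Finset.sum_eq_zero fun p _ => ?_
  rw [pSeries, PowerSeries.coeff_mk, mul_assoc, MvPolynomial.coeff_C_mul,
    MvPolynomial.coeff_X_mul']
  split_ifs with h
  · rw [hf, mul_zero]
    have h1 : d = (d - Finsupp.single p.1 1) + Finsupp.single p.1 1 :=
      (tsub_add_cancel_of_le (by
        rw [Finsupp.single_le_iff]; rw [Finsupp.mem_support_iff] at h; omega)).symm
    rw [h1, map_add, Finsupp.degree_single] at hd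
    omega
  · rw [mul_zero]

theorem degreeLT_one : DegreeLT 1 (1 : (MvPolynomial ℕ ℚ)⟦X⟧) := fun n d hd => by
  rw [PowerSeries.coeff_one]
  split_ifs
  · rw [MvPolynomial.coeff_one, if_neg]
    rintro rfl
    simp at hd
  · simp

theorem degreeLT_neg_pSeries_pow (m : ℕ) : DegreeLT (m + 1) ((-pSeries) ^ m) := by
  induction m with
  | zero => simpa using degreeLT_one
  | succ m ih =>
    rw [pow_succ', neg_mul]
    exact ih.pSeries_mul.neg

/-- In the expansion of `(θ - P)^m 1`, `θ` keeps the degree in the `t_i` and `P` raises it by one,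
so only the word made of `-P` alone reaches degree `m`. -/
theorem degreeLT_conjSeries_sub (m : ℕ) : DegreeLT m (conjSeries m - (-pSeries) ^ m) := by
  induction m with
  | zero => intro n d _; simp [conjSeries_zero]
  | succ m ih =>
    have h1 : DegreeLT (m + 1) (conjSeries m) := by
      simpa using (ih.mono (Nat.le_succ m)).add (degreeLT_neg_pSeries_pow m)
    have h2 : conjSeries (m + 1) - (-pSeries) ^ (m + 1) =
        SpectralCurve.eulerOp (conjSeries m) + -(pSeries * (conjSeries m - (-pSeries) ^ m)) := by
      rw [conjSeries_succ]; ring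
    rw [h2]
    exact h1.eulerOp.add ih.pSeries_mul.neg

theorem degreeLT_conjSeries (m : ℕ) : DegreeLT (m + 1) (conjSeries m) := by
  simpa using ((degreeLT_conjSeries_sub m).mono (Nat.le_succ m)).add (degreeLT_neg_pSeries_pow m)

/-- The signed hook Schur function `(-1)^b s_{(N-b, 1^b)} = ∑_{i ≤ b} (-1)^i h_{N-i} e_i`. -/
def hookSum (N b : ℕ) : MvPolynomial ℕ ℚ :=
  ∑ i ∈ Finset.range (b + 1), hPoly ℚ ((N - i : ℕ) : ℤ) * coeff i eSeries

theorem coeff_conjSeries (m N : ℕ) : coeff N (conjSeries m) =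
    ∑ i ∈ Finset.range (N + 1), MvPolynomial.C ((i : ℚ) ^ m) *
      (hPoly ℚ ((N - i : ℕ) : ℤ) * coeff i eSeries) := by
  rw [conjSeries, mul_comm, PowerSeries.coeff_mul, Finset.Nat.sum_antidiagonal_eq_sum_range_succ_mk]
  refine Finset.sum_congr rfl fun i _ => ?_
  rw [coeff_iterate_eulerOp, hSeries, PowerSeries.coeff_mk]
  ring

/-- Summation by parts against powers, by Bernoulli polynomials. -/
theorem sum_pow_mul_partialSum {A : Type*} [CommRing A] [Algebra ℚ A] (m N : ℕ) (a : ℕ → A)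
    (ha : ∑ i ∈ Finset.range (N + 1), a i = 0) :
    algebraMap ℚ A ((m : ℚ) + 1) * ∑ b ∈ Finset.range N, algebraMap ℚ A ((b : ℚ) ^ m) *
      ∑ i ∈ Finset.range (b + 1), a i =
    -∑ j ∈ Finset.range (m + 2), algebraMap ℚ A ((Polynomial.bernoulli (m + 1)).coeff j) *
      ∑ i ∈ Finset.range (N + 1), algebraMap ℚ A ((i : ℚ) ^ j) * a i := by
  have heval : ∀ x : ℚ, (Polynomial.bernoulli (m + 1)).eval x =
      ∑ j ∈ Finset.range (m + 2), (Polynomial.bernoulli (m + 1)).coeff j * x ^ j := by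
    intro x
    refine Polynomial.eval_eq_sum_range' ?_ x
    rw [Nat.lt_succ_iff, Polynomial.natDegree_le_iff_coeff_eq_zero]
    intro i hi
    rw [Polynomial.coeff_bernoulli, if_neg (by omega)]
  have h1 : ∑ b ∈ Finset.range N, algebraMap ℚ A ((b : ℚ) ^ m) *
        ∑ i ∈ Finset.range (b + 1), a i =
      ∑ i ∈ Finset.range (N + 1),
        algebraMap ℚ A (∑ b ∈ Finset.Ico i N, (b : ℚ) ^ m) * a i := by
    simp only [Finset.mul_sum, map_sum, Finset.sum_mul]
    refine Finset.sum_comm' fun b i => ?_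
    simp only [Finset.mem_range, Finset.mem_Ico]
    omega
  -- Faulhaber's formula. The part `B_{m+1}(N)` does not depend on `i`, so it disappears on summing
  -- against `a`, whose total is zero.
  have h2 : ∀ i ∈ Finset.range (N + 1), ((m : ℚ) + 1) * ∑ b ∈ Finset.Ico i N, (b : ℚ) ^ m =
      (Polynomial.bernoulli (m + 1)).eval (N : ℚ) -
        (Polynomial.bernoulli (m + 1)).eval (i : ℚ) := by
    intro i hi
    rw [Finset.sum_Ico_eq_sub _ (by simpa [Nat.lt_succ_iff] using hi), mul_sub,
      Polynomial.sum_range_pow_eq_bernoulli_sub, Polynomial.sum_range_pow_eq_bernoulli_sub]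
    exact sub_sub_sub_cancel_right _ _ _
  rw [h1, Finset.mul_sum]
  calc _ = ∑ i ∈ Finset.range (N + 1),
        (algebraMap ℚ A ((Polynomial.bernoulli (m + 1)).eval (N : ℚ)) * a i -
          algebraMap ℚ A ((Polynomial.bernoulli (m + 1)).eval (i : ℚ)) * a i) := by
        refine Finset.sum_congr rfl fun i hi => ?_
        rw [← mul_assoc, ← map_mul, h2 i hi, map_sub, sub_mul]
    _ = -∑ i ∈ Finset.range (N + 1),
          algebraMap ℚ A ((Polynomial.bernoulli (m + 1)).eval (i : ℚ)) * a i := by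
        rw [Finset.sum_sub_distrib, ← Finset.mul_sum, ha, mul_zero, zero_sub]
    _ = _ := by
        simp only [heval, map_sum, Finset.sum_mul, Finset.mul_sum]
        rw [Finset.sum_comm]
        congr 1
        refine Finset.sum_congr rfl fun j _ => Finset.sum_congr rfl fun i _ => ?_
        rw [map_mul, mul_assoc]

theorem sum_pow_mul_hookSum (m N : ℕ) (hN : N ≠ 0) :
    MvPolynomial.C ((m : ℚ) + 1) *
      ∑ b ∈ Finset.range N, MvPolynomial.C ((b : ℚ) ^ m) * hookSum N b =
    -∑ j ∈ Finset.range (m + 2),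
      MvPolynomial.C ((Polynomial.bernoulli (m + 1)).coeff j) * coeff N (conjSeries j) := by
  simp only [coeff_conjSeries]
  refine sum_pow_mul_partialSum m N
    (fun i => hPoly ℚ ((N - i : ℕ) : ℤ) * coeff i eSeries) ?_
  -- The total sum vanishes because it is `[z^N] H H⁻¹` with `N ≠ 0`.
  have h := coeff_conjSeries 0 N
  rw [conjSeries_zero, PowerSeries.coeff_one, if_neg hN] at h
  simpa only [pow_zero, map_one, one_mul] using h.symm

/-- In degree `k + 1` only the top power of `b` contributes to `∑_b b^m (-1)^b s_{(N-b, 1^b)}`. -/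
theorem coeff_sum_pow_mul_hookSum {m k N : ℕ} (hN : N ≠ 0) (hm : m ≤ k) {d : ℕ →₀ ℕ}
    (hd : Finsupp.degree d = k + 1) :
    ∑ b ∈ Finset.range N, (b : ℚ) ^ m * MvPolynomial.coeff d (hookSum N b) =
      if m = k then (-1) ^ k / ((k : ℚ) + 1) * MvPolynomial.coeff d (coeff N (pSeries ^ (k + 1)))
      else 0 := by
  have h := congrArg (MvPolynomial.coeff d) (sum_pow_mul_hookSum m N hN)
  simp only [MvPolynomial.coeff_C_mul, MvPolynomial.coeff_sum, MvPolynomial.coeff_neg] at h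
  -- For `j ≤ m ≤ k` the degree in the variables is at most `k`, too small for `d`; only `j = m + 1`
  -- is left.
  rw [Finset.sum_range_succ (n := m + 1), Finset.sum_eq_zero (s := Finset.range (m + 1)), zero_add] at h
  · have hlead : (Polynomial.bernoulli (m + 1)).coeff (m + 1) = 1 := by
      simp [Polynomial.coeff_bernoulli]
    rw [hlead, one_mul] at h
    have hm0 : (m : ℚ) + 1 ≠ 0 := by positivity
    rw [mul_comm, ← eq_div_iff hm0] at h
    split_ifs with hmk
    · subst hmk
      have h2 := degreeLT_conjSeries_sub (m + 1) N d hd.ge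
      rw [map_sub, MvPolynomial.coeff_sub, sub_eq_zero] at h2
      rw [h, h2, neg_pow, show ((-1 : (MvPolynomial ℕ ℚ)⟦X⟧)) ^ (m + 1) =
        PowerSeries.C (MvPolynomial.C ((-1) ^ (m + 1))) by simp,
        PowerSeries.coeff_C_mul, MvPolynomial.coeff_C_mul]
      ring
    · rw [h, degreeLT_conjSeries (m + 1) N d (by omega)]
      simp
  · intro j hj
    rw [degreeLT_conjSeries j N d (by rw [Finset.mem_range] at hj; omega), mul_zero]

end SymmetricFunctions

/-! ### Hook Schur functions, and the coefficient of `t_N` in a Schur function -/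

section HookSchur

open PowerSeries

/-- A Hessenberg determinant: if the rows below the first are `h_{j-i}` and annihilate a vector `w`
with last entry `1`, the determinant is, up to sign, the product of the first row with `w`. -/
theorem det_hessenberg {R : Type*} [CommRing R] {b : ℕ} (A : Matrix (Fin (b + 1)) (Fin (b + 1)) R)
    (w : Fin (b + 1) → R) (hw : w (Fin.last b) = 1)
    (hrow : ∀ i : Fin b, A.mulVec w i.succ = 0)
    (hdiag : ∀ i : Fin b, A i.succ i.castSucc = 1)
    (hlow : ∀ i j : Fin b, j < i → A i.succ j.castSucc = 0) :
    A.det = (-1) ^ b * A.mulVec w 0 := by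
  -- Replacing the last column by `A w` multiplies the determinant by the last entry of `w`, which
  -- is `1`. The new column is zero below its top entry, and the complementary minor is
  -- unitriangular.
  have h1 : A.det = (A.updateCol (Fin.last b) (A.mulVec w)).det := by
    rw [← Matrix.cramer_apply, Matrix.cramer_eq_adjugate_mulVec, Matrix.mulVec_mulVec,
      Matrix.adjugate_mul, Matrix.smul_mulVec, Matrix.one_mulVec, Pi.smul_apply, hw, smul_eq_mul,
      mul_one]
  rw [h1, Matrix.det_succ_column _ (Fin.last b), Fin.sum_univ_succ, Finset.sum_eq_zero, add_zero]
  · have h2 : ((A.updateCol (Fin.last b) (A.mulVec w)).submatrix (Fin.succAbove 0)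
        (Fin.succAbove (Fin.last b))).det = 1 := by
      rw [Matrix.det_of_isUpperTriangular]
      · refine Finset.prod_eq_one fun i _ => ?_
        simp [hdiag]
      · intro i j hij
        have hij : j < i := hij
        simp [hlow i j hij]
    rw [h2]
    simp
  · intro i _
    simp [hrow]

theorem schur_eq_det (R : Type*) [CommRing R] [Algebra ℚ R] {N n : ℕ} (lam : Nat.Partition N)
    (h : lam.parts.card = n) :
    schur R lam = Matrix.det (Matrix.of fun i j : Fin n =>
      hPoly R ((rowLen lam i : ℤ) - (i : ℤ) + (j : ℤ))) := by
  subst h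
  rfl

theorem schur_eq_map (R : Type*) [CommRing R] [Algebra ℚ R] {N : ℕ} (lam : Nat.Partition N) :
    schur R lam = MvPolynomial.map (algebraMap ℚ R) (schur ℚ lam) := by
  rw [schur, schur, RingHom.map_det]
  congr 1
  ext1 i j
  simp [hPoly_eq_map R]

/-- The hook partition `(N - b, 1^b)`. -/
def hook (N b : ℕ) (h : b < N) : Nat.Partition N where
  parts := (N - b) ::ₘ Multiset.replicate b 1
  parts_pos := by
    intro i hi
    rw [Multiset.mem_cons] at hi
    rcases hi with rfl | hi
    · omega
    · rw [Multiset.eq_of_mem_replicate hi]; exact one_pos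
  parts_sum := by simp; omega

theorem card_hook {N b : ℕ} (h : b < N) : (hook N b h).parts.card = b + 1 := by
  simp [hook]

theorem sort_hook {N b : ℕ} (h : b < N) :
    (hook N b h).parts.sort (· ≥ ·) = (N - b) :: List.replicate b 1 := by
  rw [hook, Multiset.sort_cons]
  · congr 1
    rw [List.eq_replicate_iff]
    refine ⟨by simp, fun i hi => ?_⟩
    rw [Multiset.mem_sort] at hi
    exact Multiset.eq_of_mem_replicate hi
  · intro i hi
    rw [Multiset.eq_of_mem_replicate hi]
    show N - b ≥ 1
    omega

theorem rowLen_hook_zero {N b : ℕ} (h : b < N) : rowLen (hook N b h) 0 = N - b := by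
  rw [rowLen, sort_hook]; rfl

theorem rowLen_hook_succ {N b i : ℕ} (h : b < N) (hi : i < b) :
    rowLen (hook N b h) (i + 1) = 1 := by
  rw [rowLen, sort_hook]
  simp [List.getD, hi]

/-- Hook Schur functions as partial sums of `H(z) H(z)⁻¹`. -/
theorem schur_hook {N b : ℕ} (h : b < N) :
    schur ℚ (hook N b h) = (-1) ^ b * hookSum N b := by
  -- Row `i + 1` has entries `h_{j-i}`, so its product with this vector is `[z^{b-i}] H H⁻¹`, which
  -- is zero since `i < b`.
  rw [schur_eq_det ℚ _ (card_hook h), det_hessenberg _ fun j => coeff (b - j) eSeries]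
  · congr 1
    refine (Fin.sum_univ_eq_sum_range
      (fun j => hPoly ℚ ((rowLen (hook N b h) 0 : ℤ) - ((0 : ℕ) : ℤ) + (j : ℤ)) *
        coeff (b - j) eSeries) (b + 1)).trans ?_
    rw [hookSum, ← Finset.sum_range_reflect]
    refine Finset.sum_congr rfl fun i hi => ?_
    rw [Finset.mem_range] at hi
    rw [rowLen_hook_zero, show b - (b + 1 - 1 - i) = i by omega]
    congr 2
    omega
  · simp [coeff_zero_eSeries]
  · intro i
    have hH := congrArg (coeff (b - i)) hSeries_mul_eSeries
    rw [PowerSeries.coeff_one, if_neg (by omega), PowerSeries.coeff_mul,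
      Finset.Nat.sum_antidiagonal_eq_sum_range_succ_mk] at hH
    refine (Fin.sum_univ_eq_sum_range
      (fun j => hPoly ℚ ((rowLen (hook N b h) (i + 1) : ℤ) - ((i + 1 : ℕ) : ℤ) + (j : ℤ)) *
        coeff (b - j) eSeries) (b + 1)).trans ?_
    rw [rowLen_hook_succ h i.2,
      ← Finset.sum_range_add_sum_Ico _ (show (i : ℕ) ≤ b + 1 by omega), Finset.sum_eq_zero,
      zero_add, Finset.sum_Ico_eq_sum_range, ← hH, show b + 1 - (i : ℕ) = (b - i).succ by omega]
    · refine Finset.sum_congr rfl fun j hj => ?_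
      rw [hSeries, PowerSeries.coeff_mk]
      congr 2
      · push_cast; ring
      · congr 1; omega
    · intro j hj
      rw [Finset.mem_range] at hj
      rw [hPoly_of_neg ℚ (by push_cast; omega), zero_mul]
  · intro i
    simp [rowLen_hook_succ h i.2, hPoly_zero]
  · intro i j hij
    simp only [Matrix.of_apply, Fin.val_succ, Fin.val_castSucc, rowLen_hook_succ h i.2]
    exact hPoly_of_neg ℚ (by rw [Fin.lt_def] at hij; push_cast; omega)

/-- The coefficient of a single variable is a derivation over evaluation at the origin. -/
theorem coeff_single_mul {R : Type*} [CommRing R] (N : ℕ) (p q : MvPolynomial ℕ R) :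
    MvPolynomial.coeff (Finsupp.single N 1) (p * q) =
      MvPolynomial.coeff 0 p * MvPolynomial.coeff (Finsupp.single N 1) q +
        MvPolynomial.coeff (Finsupp.single N 1) p * MvPolynomial.coeff 0 q := by
  rw [MvPolynomial.coeff_mul, Finsupp.antidiagonal_single]
  simp [Finset.Nat.antidiagonal_succ]

theorem coeff_zero_hPoly {n : ℕ} (hn : n ≠ 0) : MvPolynomial.coeff 0 (hPoly ℚ n) = 0 := by
  rw [coeff_hPoly, if_neg]
  simp [hn.symm]

theorem coeff_single_hPoly {n N : ℕ} (hN : N ≠ 0) :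
    MvPolynomial.coeff (Finsupp.single N 1) (hPoly ℚ n) = if N = n then 1 else 0 := by
  rw [coeff_hPoly, Finsupp.weight_single, Finsupp.single_eq_of_ne hN.symm]
  simp [invFactorialProd]

theorem coeff_single_hookSum {N b : ℕ} (h : b < N) :
    MvPolynomial.coeff (Finsupp.single N 1) (hookSum N b) = 1 := by
  rw [hookSum, MvPolynomial.coeff_sum, Finset.sum_eq_single 0]
  · rw [coeff_zero_eSeries, mul_one, coeff_single_hPoly (by omega), if_pos (by simp)]
  · intro i hi hi0
    rw [Finset.mem_range] at hi
    rw [coeff_single_mul, coeff_zero_hPoly (by omega), coeff_single_hPoly (by omega),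
      if_neg (by omega), zero_mul, zero_mul, add_zero]
  · simp

/-- A partition whose corner hook has length `N` is a hook. -/
theorem exists_eq_hook {N : ℕ} (lam : Nat.Partition N) {j : ℕ} (hj : j < lam.parts.card)
    (h : rowLen lam 0 + j = N) : ∃ (b : ℕ) (hb : b < N), lam = hook N b hb := by
  have hlen : (lam.parts.sort (· ≥ ·)).length = lam.parts.card := Multiset.length_sort _
  have hparts : ((lam.parts.sort (· ≥ ·) : List ℕ) : Multiset ℕ) = lam.parts :=
    Multiset.sort_eq _ _
  rw [rowLen] at h
  generalize lam.parts.sort (· ≥ ·) = l at hlen hparts h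
  rcases l with _ | ⟨a, l⟩
  · simp at hlen; omega
  simp only [List.getD_cons_zero, List.length_cons] at h hlen
  have hsum : a + l.sum = N := by
    rw [← lam.parts_sum, ← hparts]; simp
  have hpos : ∀ x ∈ l, 1 ≤ x := fun x hx => lam.parts_pos (by rw [← hparts]; simp [hx])
  have ha : 0 < a := lam.parts_pos (by rw [← hparts]; simp)
  -- The parts below the first sum to `j`, and there are at least `j` of them, each at least `1`;
  -- hence all equal `1`.
  have hle : l.length ≤ l.sum := by
    simpa using List.card_nsmul_le_sum l 1 hpos
  have hl : l = List.replicate j 1 := by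
    rw [List.eq_replicate_iff]
    refine ⟨by omega, fun x hx => ?_⟩
    by_contra hne
    have h2 : (l.erase x).length ≤ (l.erase x).sum := by
      simpa using List.card_nsmul_le_sum (l.erase x) 1
        fun y hy => hpos y (List.mem_of_mem_erase hy)
    rw [List.length_erase_of_mem hx] at h2
    have h3 := List.sum_erase hx
    have h4 := hpos x hx
    omega
  refine ⟨j, by omega, Nat.Partition.ext ?_⟩
  have hja : N - j = a := by omega
  simp only [hook, ← hparts, hl, hja, ← Multiset.cons_coe, Multiset.coe_replicate]

theorem exists_card_parts_eq_succ {N : ℕ} (hN : N ≠ 0) (lam : Nat.Partition N) :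
    ∃ n, lam.parts.card = n + 1 := by
  refine Nat.exists_eq_succ_of_ne_zero fun h0 => hN ?_
  rw [Multiset.card_eq_zero] at h0
  rw [← lam.parts_sum, h0, Multiset.sum_zero]

theorem rowLen_zero_pos {N : ℕ} (hN : N ≠ 0) (lam : Nat.Partition N) : 0 < rowLen lam 0 := by
  obtain ⟨n, hn⟩ := exists_card_parts_eq_succ hN lam
  have hlen : (lam.parts.sort (· ≥ ·)).length = lam.parts.card := Multiset.length_sort _
  have h0 : 0 < (lam.parts.sort (· ≥ ·)).length := by omega
  rw [rowLen, List.getD_eq_getElem _ _ h0]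
  exact lam.parts_pos ((Multiset.mem_sort _).mp (List.getElem_mem h0))

/-- The coefficient of `t_N` in a Schur function vanishes unless the partition is a hook. -/
theorem coeff_single_schur_of_not_hook {N : ℕ} (hN : N ≠ 0) (lam : Nat.Partition N)
    (h : ¬ ∃ (b : ℕ) (hb : b < N), lam = hook N b hb) :
    MvPolynomial.coeff (Finsupp.single N 1) (schur ℚ lam) = 0 := by
  obtain ⟨n, hn⟩ := exists_card_parts_eq_succ hN lam
  have hpos := rowLen_zero_pos hN lam
  rw [schur_eq_det ℚ lam hn, Matrix.det_succ_row_zero, MvPolynomial.coeff_sum]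
  refine Finset.sum_eq_zero fun j _ => ?_
  have hentry : Matrix.of (fun i j : Fin (n + 1) =>
      hPoly ℚ ((rowLen lam i : ℤ) - (i : ℤ) + (j : ℤ))) 0 j =
        hPoly ℚ ((rowLen lam 0 + j : ℕ) : ℤ) := by
    simp
  -- A first-row entry has positive index, hence no constant term, so `t_N` has to come from the
  -- entry itself. That forces its index `λ_0 + j` to be `N`, which makes the partition a hook.
  rw [hentry, mul_assoc, mul_left_comm, coeff_single_mul, coeff_zero_hPoly (by omega),
    coeff_single_hPoly hN, if_neg, zero_mul, zero_mul, add_zero]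
  intro hNj
  exact h (exists_eq_hook lam (by rw [hn]; exact j.2) hNj.symm)

/-- Sums over partitions that only see the coefficient of `t_N` are sums over hooks. -/
theorem sum_coeff_single_schur {A : Type*} [CommRing A] [Algebra ℚ A] {N : ℕ} (hN : N ≠ 0)
    (f : Nat.Partition N → A) :
    ∑ lam : Nat.Partition N,
      algebraMap ℚ A (MvPolynomial.coeff (Finsupp.single N 1) (schur ℚ lam)) * f lam =
    ∑ b : Fin N, algebraMap ℚ A ((-1) ^ (b : ℕ)) * f (hook N b b.2) := by
  have hinj : Function.Injective fun b : Fin N => hook N b b.2 := by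
    intro b c hbc
    have := congrArg (fun lam : Nat.Partition N => lam.parts.card) hbc
    simp only [card_hook] at this
    exact Fin.ext (by omega)
  symm
  refine Finset.sum_of_injOn _ hinj.injOn (fun _ _ => Finset.mem_coe.mpr (Finset.mem_univ _))
    (fun lam _ hlam => ?_) (fun b _ => ?_)
  · rw [coeff_single_schur_of_not_hook hN, map_zero, zero_mul]
    rintro ⟨b, hb, rfl⟩
    exact hlam ⟨⟨b, hb⟩, by simp, rfl⟩
  · have h1 : MvPolynomial.coeff (Finsupp.single N 1) (schur ℚ (hook N b b.2)) =
        (-1) ^ (b : ℕ) := by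
      rw [schur_hook, show ((-1 : MvPolynomial ℕ ℚ)) ^ (b : ℕ) =
        MvPolynomial.C ((-1) ^ (b : ℕ)) by simp, MvPolynomial.coeff_C_mul,
        coeff_single_hookSum b.2, mul_one]
    rw [h1]

end HookSchur

/-! ### Content products of hooks as polynomials in the leg length `b` -/

section ContentProduct

open Polynomial

/-- `P ∈ K[b][β]` has coefficients of `β^k` of degree at most `k` in `b`, with top coefficients the
coefficients of `p`. -/
def HasTopPart {K : Type*} [CommRing K] (P : K[X][X]) (p : K[X]) : Prop :=
  ∀ k, (P.coeff k).natDegree ≤ k ∧ (P.coeff k).coeff k = p.coeff k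

/-- The top part behaves like a principal symbol for the filtration by `b`-degree at most
`β`-degree, so top parts multiply. -/
theorem HasTopPart.mul {K : Type*} [CommRing K] {P Q : K[X][X]} {p q : K[X]}
    (hP : HasTopPart P p) (hQ : HasTopPart Q q) : HasTopPart (P * Q) (p * q) := by
  intro k
  simp only [Polynomial.coeff_mul, Polynomial.finsetSum_coeff]
  constructor
  · refine Polynomial.natDegree_sum_le_of_forall_le _ _ fun x hx => ?_
    rw [Finset.HasAntidiagonal.mem_antidiagonal] at hx
    exact hx ▸ Polynomial.natDegree_mul_le_of_le (hP _).1 (hQ _).1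
  · refine Finset.sum_congr rfl fun x hx => ?_
    rw [Finset.HasAntidiagonal.mem_antidiagonal] at hx
    rw [← hx, ← Polynomial.coeff_mul, Polynomial.coeff_mul_add_eq_of_natDegree_le (hP _).1 (hQ _).1,
      (hP _).2, (hQ _).2]

theorem hasTopPart_one {K : Type*} [CommRing K] : HasTopPart (1 : K[X][X]) 1 := by
  intro k
  rw [Polynomial.coeff_one]
  split_ifs with h
  · subst h; simp
  · simp [Polynomial.coeff_one, h]

theorem HasTopPart.prod_range {K : Type*} [CommRing K] {P : ℕ → K[X][X]} {p : K[X]}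
    (h : ∀ c, HasTopPart (P c) p) (N : ℕ) :
    HasTopPart (∏ c ∈ Finset.range N, P c) (p ^ N) := by
  induction N with
  | zero => simpa using hasTopPart_one
  | succ N ih => rw [Finset.prod_range_succ, pow_succ]; exact ih.mul (h N)

/-- `G((c - b) β)` as a polynomial in `b` and `β`. -/
def contentFactor {K : Type*} [CommRing K] (G : K[X]) (c : ℕ) : K[X][X] :=
  (G.map Polynomial.C).comp (Polynomial.C ((c : K[X]) - Polynomial.X) * Polynomial.X)

theorem coeff_comp_neg_X {K : Type*} [CommRing K] (p : K[X]) (k : ℕ) :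
    (p.comp (-X)).coeff k = p.coeff k * (-1) ^ k := by
  rw [show (-X : K[X]) = Polynomial.C (-1) * X by simp, Polynomial.comp_C_mul_X_coeff]

/-- Each `β` comes with a factor `c - b`, whose leading term `-b` does not depend on `c`. -/
theorem hasTopPart_contentFactor {K : Type*} [CommRing K] (G : K[X]) (c : ℕ) :
    HasTopPart (contentFactor G c) (G.comp (-X)) := by
  intro k
  have hd : ((c : K[X]) - X).natDegree ≤ 1 := by
    refine (Polynomial.natDegree_sub_le _ _).trans ?_
    simpa using Polynomial.natDegree_X_le
  have hc : ((c : K[X]) - X).coeff 1 = -1 := by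
    rw [Polynomial.coeff_sub, Polynomial.coeff_X_one, Polynomial.coeff_natCast_ite]
    simp
  rw [contentFactor, Polynomial.comp_C_mul_X_coeff, Polynomial.coeff_map]
  constructor
  · refine (Polynomial.natDegree_C_mul_le _ _).trans ?_
    simpa using Polynomial.natDegree_pow_le_of_le k hd
  · have h1 := Polynomial.coeff_pow_of_natDegree_le (m := k) hd
    rw [mul_one] at h1
    rw [Polynomial.coeff_C_mul, h1, hc, coeff_comp_neg_X]

theorem map_evalRingHom_contentFactor {K : Type*} [CommRing K] (G : K[X]) (b c : ℕ) :
    (contentFactor G c).map (Polynomial.evalRingHom (b : K)) =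
      G.comp ((((c : ℤ) - (b : ℤ) : ℤ) : K[X]) * X) := by
  rw [contentFactor, Polynomial.map_comp, Polynomial.map_map]
  have h : (Polynomial.evalRingHom (b : K)).comp Polynomial.C = RingHom.id K := by
    ext; simp
  rw [h, Polynomial.map_id]
  simp

/-- The contents of the hook are the consecutive integers from `-b` to `N - b - 1`, each taken once;
the column is read from the bottom up. -/
theorem contentProduct_hook (M : ℕ) {N b : ℕ} (h : b < N) :
    contentProduct M (hook N b h) = ∏ c ∈ Finset.range N,
      (weightG M).comp ((((c : ℤ) - (b : ℤ) : ℤ) : (CoeffRing M)[X]) * Polynomial.X) := by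
  obtain ⟨a, rfl⟩ := Nat.exists_eq_add_of_le h.le
  rw [contentProduct, card_hook, Finset.prod_range_succ', rowLen_hook_zero, Finset.prod_range_add,
    Nat.add_sub_cancel_left]
  congr 1
  · rw [← Finset.prod_range_reflect]
    refine Finset.prod_congr rfl fun i hi => ?_
    rw [Finset.mem_range] at hi
    rw [rowLen_hook_succ h (by omega), Finset.prod_range_one]
    congr 3
    omega
  · refine Finset.prod_congr rfl fun i hi => ?_
    congr 3
    push_cast
    ring

/-- The coefficient of `β^k` in the content product of the hook `(N - b, 1^b)` is a polynomial in `b`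
of degree at most `k`, with top coefficient `(-1)^k [z^k] G(z)^N`. -/
theorem exists_coeff_contentProduct_hook (M N k : ℕ) :
    ∃ q : ℕ → CoeffRing M, q k = (-1) ^ k * (weightG M ^ N).coeff k ∧
      ∀ (b : ℕ) (h : b < N), (contentProduct M (hook N b h)).coeff k =
        ∑ m ∈ Finset.range (k + 1), q m * (b : CoeffRing M) ^ m := by
  set P := ∏ c ∈ Finset.range N, contentFactor (weightG M) c
  have hP := HasTopPart.prod_range (fun c => hasTopPart_contentFactor (weightG M) c) N k
  refine ⟨(P.coeff k).coeff, ?_, fun b h => ?_⟩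
  · rw [hP.2, ← Polynomial.pow_comp, coeff_comp_neg_X, mul_comm]
  · rw [← Polynomial.eval_eq_sum_range' (Nat.lt_succ_of_le hP.1), contentProduct_hook,
      ← Polynomial.coe_evalRingHom, ← Polynomial.coeff_map, Polynomial.map_prod]
    simp only [map_evalRingHom_contentFactor]

end ContentProduct

/-! ### The part of `ln τ` linear in `𝐭` -/

section Logarithm

open PowerSeries

theorem exists_sumElim (m : ℕ ⊕ ℕ →₀ ℕ) : ∃ d e : ℕ →₀ ℕ, m = Finsupp.sumElim d e :=
  ⟨_, _, (Finsupp.sumFinsuppEquivProdFinsupp.symm_apply_apply m).symm⟩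

theorem sumElim_inj {d e d' e' : ℕ →₀ ℕ} :
    Finsupp.sumElim d e = Finsupp.sumElim d' e' ↔ d = d' ∧ e = e' := by
  constructor
  · intro h
    exact ⟨Finsupp.ext fun i => by simpa using DFunLike.congr_fun h (Sum.inl i),
      Finsupp.ext fun i => by simpa using DFunLike.congr_fun h (Sum.inr i)⟩
  · rintro ⟨rfl, rfl⟩; rfl

theorem coeff_rename_mul_rename {R : Type*} [CommRing R] (p q : MvPolynomial ℕ R)
    (d e : ℕ →₀ ℕ) :
    MvPolynomial.coeff (Finsupp.sumElim d e)
      (MvPolynomial.rename Sum.inl p * MvPolynomial.rename Sum.inr q) =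
      MvPolynomial.coeff d p * MvPolynomial.coeff e q := by
  induction p using MvPolynomial.induction_on' with
  | add p p' hp hp' => simp only [map_add, add_mul, MvPolynomial.coeff_add, hp, hp']
  | monomial a r =>
    induction q using MvPolynomial.induction_on' with
    | add q q' hq hq' => simp only [map_add, mul_add, MvPolynomial.coeff_add, hq, hq']
    | monomial b s =>
      simp only [MvPolynomial.rename_monomial, MvPolynomial.monomial_mul,
        MvPolynomial.coeff_monomial, ← Finsupp.sumElim_eq_add, sumElim_inj]
      split_ifs <;> simp_all

/-- A polynomial in `𝐭` and `𝐬` that vanishes at `𝐭 = 0`. -/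
def VanishesAtZero {R : Type*} [CommRing R] (p : MvPolynomial (ℕ ⊕ ℕ) R) : Prop :=
  ∀ e : ℕ →₀ ℕ, MvPolynomial.coeff (Finsupp.sumElim 0 e) p = 0

theorem VanishesAtZero.coeff_mul {R : Type*} [CommRing R] {p q : MvPolynomial (ℕ ⊕ ℕ) R}
    (hp : VanishesAtZero p) (hq : VanishesAtZero q) (N : ℕ) (e : ℕ →₀ ℕ) :
    MvPolynomial.coeff (Finsupp.sumElim (Finsupp.single N 1) e) (p * q) = 0 := by
  rw [MvPolynomial.coeff_mul]
  refine Finset.sum_eq_zero fun x hx => ?_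
  rw [Finset.HasAntidiagonal.mem_antidiagonal] at hx
  obtain ⟨x, y⟩ := x
  obtain ⟨d₁, e₁, rfl⟩ := exists_sumElim x
  obtain ⟨d₂, e₂, rfl⟩ := exists_sumElim y
  rw [← Finsupp.sumElim_add, sumElim_inj] at hx
  have hd : (d₁, d₂) ∈ Finset.HasAntidiagonal.antidiagonal (Finsupp.single N 1) := by
    rw [Finset.HasAntidiagonal.mem_antidiagonal]; exact hx.1
  rw [Finsupp.antidiagonal_single] at hd
  simp only [Finset.Nat.antidiagonal_succ, Finset.Nat.antidiagonal_zero, Finset.map_singleton,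
    Finset.map_cons, Finset.mem_cons, Finset.mem_singleton, Function.Embedding.coe_prodMap,
    Function.Embedding.coeFn_mk, Prod.map, Prod.mk.injEq, Nat.succ_eq_add_one, zero_add,
    Finsupp.single_zero, Function.Embedding.refl_apply] at hd
  rcases hd with ⟨rfl, -⟩ | ⟨-, rfl⟩
  · rw [hp, zero_mul]
  · rw [hq, mul_zero]

theorem VanishesAtZero.mul_right {R : Type*} [CommRing R] {p : MvPolynomial (ℕ ⊕ ℕ) R}
    (hp : VanishesAtZero p) (q : MvPolynomial (ℕ ⊕ ℕ) R) : VanishesAtZero (p * q) := by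
  intro e
  rw [MvPolynomial.coeff_mul]
  refine Finset.sum_eq_zero fun x hx => ?_
  rw [Finset.HasAntidiagonal.mem_antidiagonal] at hx
  obtain ⟨x, y⟩ := x
  obtain ⟨d₁, e₁, rfl⟩ := exists_sumElim x
  obtain ⟨d₂, e₂, rfl⟩ := exists_sumElim y
  rw [← Finsupp.sumElim_add, sumElim_inj, add_eq_zero] at hx
  rw [hx.1.1, hp, zero_mul]

theorem VanishesAtZero.sum {R ι : Type*} [CommRing R] {s : Finset ι}
    {p : ι → MvPolynomial (ℕ ⊕ ℕ) R} (hp : ∀ i ∈ s, VanishesAtZero (p i)) :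
    VanishesAtZero (∑ i ∈ s, p i) := by
  intro e
  rw [MvPolynomial.coeff_sum]
  exact Finset.sum_eq_zero fun i hi => hp i hi e

/-- If every coefficient of `f - 1` vanishes at `𝐭 = 0`, then `log f` and `f` have the same terms
linear in `𝐭`. -/
theorem coeff_logOf {R : Type*} [CommRing R] [Algebra ℚ R] {f : (MvPolynomial (ℕ ⊕ ℕ) R)⟦X⟧}
    (hf0 : constantCoeff f = 1) (hf : ∀ n, VanishesAtZero (coeff n (f - 1)))
    (n N : ℕ) (e : ℕ →₀ ℕ) :
    MvPolynomial.coeff (Finsupp.sumElim (Finsupp.single N 1) e) (coeff n (logOf f)) =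
      MvPolynomial.coeff (Finsupp.sumElim (Finsupp.single N 1) e) (coeff n (f - 1)) := by
  have hs : HasSubst (f - 1) := HasSubst.of_constantCoeff_zero' (by simp [hf0])
  -- `log (1 + z)` agrees with `z` modulo `z²`, and a product of two factors vanishing at `𝐭 = 0`
  -- has no term linear in `𝐭`.
  obtain ⟨g, hg⟩ : (X : (MvPolynomial (ℕ ⊕ ℕ) R)⟦X⟧) ^ 2 ∣
      log (MvPolynomial (ℕ ⊕ ℕ) R) - X := by
    rw [PowerSeries.X_pow_dvd_iff]
    intro m hm
    interval_cases m <;> simp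
  have hlog : logOf f = (f - 1) + (f - 1) * ((f - 1) * PowerSeries.subst (f - 1) g) := by
    rw [PowerSeries.logOf_eq, eq_add_of_sub_eq hg, PowerSeries.subst_add hs,
      PowerSeries.subst_mul hs, PowerSeries.subst_pow hs, PowerSeries.subst_X hs]
    ring
  rw [hlog, map_add, MvPolynomial.coeff_add, PowerSeries.coeff_mul, MvPolynomial.coeff_sum,
    Finset.sum_eq_zero, add_zero]
  intro x _
  refine (hf _).coeff_mul ?_ N e
  rw [PowerSeries.coeff_mul]
  exact VanishesAtZero.sum fun y _ => (hf _).mul_right _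

/-- Every entry in the first row of the Jacobi–Trudi matrix has positive index, hence no constant
term. -/
theorem coeff_zero_schur {N : ℕ} (hN : N ≠ 0) (lam : Nat.Partition N) :
    MvPolynomial.coeff 0 (schur ℚ lam) = 0 := by
  obtain ⟨n, hn⟩ := exists_card_parts_eq_succ hN lam
  rw [schur_eq_det ℚ lam hn, Matrix.det_succ_row_zero, MvPolynomial.coeff_sum]
  refine Finset.sum_eq_zero fun j _ => ?_
  have hpos := rowLen_zero_pos hN lam
  have hentry : Matrix.of (fun i j : Fin (n + 1) =>
      hPoly ℚ ((rowLen lam i : ℤ) - (i : ℤ) + (j : ℤ))) 0 j =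
        hPoly ℚ ((rowLen lam 0 + j : ℕ) : ℤ) := by
    simp
  rw [hentry, ← MvPolynomial.constantCoeff_eq, map_mul, map_mul, MvPolynomial.constantCoeff_eq,
    coeff_zero_hPoly (by omega)]
  simp

theorem coeff_tau_sumElim (M N : ℕ) (d e : ℕ →₀ ℕ) :
    MvPolynomial.coeff (Finsupp.sumElim d e) (coeff N (tau M)) =
      ∑ lam : Nat.Partition N, contentProduct M lam *
        (algebraMap ℚ (CoeffRing M)[X] (MvPolynomial.coeff d (schur ℚ lam)) *
          algebraMap ℚ (CoeffRing M)[X] (MvPolynomial.coeff e (schur ℚ lam))) := by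
  rw [tau, PowerSeries.coeff_mk, MvPolynomial.coeff_sum]
  refine Finset.sum_congr rfl fun lam _ => ?_
  rw [mul_assoc, MvPolynomial.coeff_C_mul, coeff_rename_mul_rename, schur_eq_map,
    MvPolynomial.coeff_map, MvPolynomial.coeff_map]

theorem coeff_zero_tau (M : ℕ) : coeff 0 (tau M) = 1 := by
  rw [tau, PowerSeries.coeff_mk, Fintype.sum_unique]
  have h : (default : Nat.Partition 0).parts.card = 0 := by simp
  rw [schur_eq_det _ _ h, contentProduct, h]
  simp

theorem coeff_logOf_tau (M N : ℕ) (hN : N ≠ 0) (e : ℕ →₀ ℕ) :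
    MvPolynomial.coeff (Finsupp.sumElim (Finsupp.single N 1) e) (coeff N (logOf (tau M))) =
      MvPolynomial.coeff (Finsupp.sumElim (Finsupp.single N 1) e) (coeff N (tau M)) := by
  rw [coeff_logOf (by rw [← PowerSeries.coeff_zero_eq_constantCoeff_apply, coeff_zero_tau]),
    map_sub, PowerSeries.coeff_one, if_neg hN, sub_zero]
  intro n
  rcases Nat.eq_zero_or_pos n with rfl | hn
  · intro e
    simp [coeff_zero_tau, -PowerSeries.coeff_zero_eq_constantCoeff]
  · intro e
    rw [map_sub, PowerSeries.coeff_one, if_neg hn.ne', sub_zero, coeff_tau_sumElim]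
    refine Finset.sum_eq_zero fun lam _ => ?_
    rw [coeff_zero_schur hn.ne', map_zero, zero_mul, mul_zero]

/-- The weighted Hurwitz numbers with one part of length `N` on one side, as sums over hooks. -/
theorem coeff_logOf_tau_eq_sum_hook (M N : ℕ) (hN : N ≠ 0) (e : ℕ →₀ ℕ) :
    MvPolynomial.coeff (Finsupp.sumElim (Finsupp.single N 1) e) (coeff N (logOf (tau M))) =
      ∑ b : Fin N, contentProduct M (hook N b b.2) *
        algebraMap ℚ (CoeffRing M)[X] (MvPolynomial.coeff e (hookSum N b)) := by
  rw [coeff_logOf_tau M N hN, coeff_tau_sumElim]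
  simp only [mul_left_comm (contentProduct M _)]
  rw [sum_coeff_single_schur hN]
  -- The sign from the coefficient of `t_N` cancels the sign relating the Schur function to
  -- `hookSum`.
  refine Finset.sum_congr rfl fun b _ => ?_
  rw [schur_hook, show ((-1 : MvPolynomial ℕ ℚ)) ^ (b : ℕ) =
    MvPolynomial.C ((-1) ^ (b : ℕ)) by simp, MvPolynomial.coeff_C_mul, map_mul,
    mul_left_comm (contentProduct M _), ← mul_assoc, ← map_mul, ← mul_pow, neg_mul_neg, one_mul,
    one_pow, map_one, one_mul]

end Logarithm

/-! ### Genus zero one-part numbers and the spectral curve -/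

section SpectralCurveEquation

open PowerSeries

/-- Bihomogeneity of the powers of `P`: the monomials in `[z^N] P^l` correspond to partitions of `N`
with exactly `l` parts. -/
theorem coeff_pSeries_pow_ne_zero (l : ℕ) : ∀ (N : ℕ) (d : ℕ →₀ ℕ),
    MvPolynomial.coeff d (coeff N (pSeries ^ l)) ≠ 0 →
      d 0 = 0 ∧ Finsupp.weight (id : ℕ → ℕ) d = N ∧ Finsupp.degree d = l := by
  induction l with
  | zero =>
    intro N d h
    rw [pow_zero, PowerSeries.coeff_one] at h
    split_ifs at h with hN
    · rw [MvPolynomial.coeff_one] at h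
      have hd : 0 = d := by by_contra hne; exact h (if_neg hne)
      subst hd
      simp [hN]
    · simp at h
  | succ l ih =>
    intro N d h
    rw [pow_succ', PowerSeries.coeff_mul, MvPolynomial.coeff_sum] at h
    obtain ⟨⟨i, j⟩, hij, h⟩ := Finset.exists_ne_zero_of_sum_ne_zero h
    rw [Finset.HasAntidiagonal.mem_antidiagonal] at hij
    simp only [pSeries, PowerSeries.coeff_mk] at h hij
    rw [mul_assoc, MvPolynomial.coeff_C_mul, MvPolynomial.coeff_X_mul'] at h
    have hi : i ≠ 0 := by rintro rfl; simp at h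
    split_ifs at h with his
    · rw [Finsupp.mem_support_iff] at his
      obtain ⟨e, rfl⟩ : ∃ e, d = e + Finsupp.single i 1 :=
        ⟨d - Finsupp.single i 1, (tsub_add_cancel_of_le (by
          rw [Finsupp.single_le_iff]; omega)).symm⟩
      rw [add_tsub_cancel_right] at h
      obtain ⟨h0, hw, hd⟩ := ih j e (right_ne_zero_of_mul h)
      refine ⟨?_, ?_, ?_⟩
      · rw [Finsupp.add_apply, h0, Finsupp.single_eq_of_ne (by omega), add_zero]
      · rw [map_add, hw, Finsupp.weight_single, one_smul, id_eq]; omega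
      · rw [map_add, hd, Finsupp.degree_single]
    · simp at h

theorem aeval_eq_sum_partition {A : Type*} [CommRing A] [Algebra ℚ A] (f : ℕ → A) {N : ℕ}
    {p : MvPolynomial ℕ ℚ} (hp : ∀ d, MvPolynomial.coeff d p ≠ 0 →
      d 0 = 0 ∧ Finsupp.weight (id : ℕ → ℕ) d = N) :
    MvPolynomial.aeval f p = ∑ ν : Nat.Partition N,
      algebraMap ℚ A (MvPolynomial.coeff (Multiset.toFinsupp ν.parts) p) *
        (ν.parts.map f).prod := by
  rw [MvPolynomial.aeval_def, MvPolynomial.eval₂_eq]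
  have hν : ∀ ν : Nat.Partition N, (ν.parts.map f).prod =
      ∏ i ∈ (Multiset.toFinsupp ν.parts).support, f i ^ (Multiset.toFinsupp ν.parts) i := by
    intro ν
    rw [Finset.prod_multiset_map_count, Multiset.toFinsupp_support]
    simp
  simp only [hν]
  rw [← Finset.sum_image (s := Finset.univ) (g := fun ν : Nat.Partition N =>
    Multiset.toFinsupp ν.parts) (f := fun d => algebraMap ℚ A (MvPolynomial.coeff d p) *
      ∏ i ∈ d.support, f i ^ d i) toFinsupp_parts_injective.injOn]
  refine Finset.sum_subset (fun d hd => ?_) (fun d _ hd => ?_)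
  · obtain ⟨h0, hw⟩ := hp d (MvPolynomial.mem_support_iff.mp hd)
    obtain ⟨ν, hν⟩ := exists_partition_toFinsupp h0 hw
    exact Finset.mem_image.mpr ⟨ν, Finset.mem_univ _, hν⟩
  · rw [MvPolynomial.notMem_support_iff.mp hd, map_zero, zero_mul]

/-- The weighted Hurwitz numbers contributing to `F̃_{0,1}`. -/
theorem connectedHurwitz_indiscrete (M : ℕ) {N k : ℕ} (hN : N ≠ 0) (ν : Nat.Partition N)
    (hk : ν.parts.card = k + 1) :
    connectedHurwitz M k (Nat.Partition.indiscrete N) ν =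
      ((N : ℚ) * (ν.parts.prod : ℚ))⁻¹ • ((((k : ℚ) + 1)⁻¹ *
        MvPolynomial.coeff (Multiset.toFinsupp ν.parts) (coeff N (pSeries ^ (k + 1)))) •
          (weightG M ^ N).coeff k) := by
  rw [connectedHurwitz, Nat.Partition.indiscrete_parts hN, Multiset.prod_singleton,
    Multiset.toFinsupp_singleton, coeff_logOf_tau_eq_sum_hook M N hN]
  congr 1
  set d := Multiset.toFinsupp ν.parts
  have hd : Finsupp.degree d = k + 1 := by rw [← hk]; exact degree_toFinsupp ν.parts
  obtain ⟨q, hq, hcoeff⟩ := exists_coeff_contentProduct_hook M N k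
  have hterm : ∀ b : Fin N, (contentProduct M (hook N b b.2) *
      algebraMap ℚ (CoeffRing M)[X] (MvPolynomial.coeff d (hookSum N b))).coeff k =
      ∑ m ∈ Finset.range (k + 1), q m * algebraMap ℚ (CoeffRing M)
        ((b : ℚ) ^ m * MvPolynomial.coeff d (hookSum N b)) := by
    intro b
    rw [IsScalarTower.algebraMap_apply ℚ (CoeffRing M) (CoeffRing M)[X],
      Polynomial.algebraMap_eq, Polynomial.coeff_mul_C, hcoeff, Finset.sum_mul]
    refine Finset.sum_congr rfl fun m _ => ?_
    rw [map_mul, map_pow, map_natCast, mul_assoc]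
  rw [Polynomial.finsetSum_coeff, Finset.sum_congr rfl fun b _ => hterm b, Finset.sum_comm]
  simp only [← Finset.mul_sum, ← map_sum]
  rw [Finset.sum_congr rfl fun m hm => by
    rw [Fin.sum_univ_eq_sum_range (fun b => (b : ℚ) ^ m * MvPolynomial.coeff d (hookSum N b)) N,
      coeff_sum_pow_mul_hookSum hN (Nat.lt_succ_iff.mp (Finset.mem_range.mp hm)) hd]]
  -- Only the leading power of `b` survives in degree `k + 1`. Its coefficient carries `(-1)^k`,
  -- which cancels the `(-1)^k` of the hook sum.
  rw [Finset.sum_eq_single k]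
  · rw [if_pos rfl, hq, Algebra.smul_def, mul_comm]
    have h1 : ((-1 : CoeffRing M)) ^ k = algebraMap ℚ (CoeffRing M) ((-1) ^ k) := by simp
    rw [h1, ← mul_assoc, ← map_mul]
    congr 2
    have h2 : ((-1 : ℚ)) ^ k * (-1) ^ k = 1 := by rw [← mul_pow]; simp
    linear_combination (((k : ℚ) + 1)⁻¹ *
      MvPolynomial.coeff d (coeff N (pSeries ^ (k + 1)))) * h2
  · intro m _ hm
    rw [if_neg hm, map_zero, mul_zero]
  · simp

theorem coeff_polyS (M L n : ℕ) :
    (polyS M L).coeff n = (n : MvPolynomial (Fin L) (CoeffRing M)) * sVar M L n := by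
  rw [polyS, Polynomial.finsetSum_coeff]
  simp only [Polynomial.coeff_C_mul_X_pow]
  rw [Finset.sum_ite_eq]
  split_ifs with h
  · rfl
  · rw [Finset.mem_Icc] at h
    rw [sVar, dif_neg h, mul_zero]

/-- The specialisation `t_i ↦ s_i` turns the power sum series `P` into `S`. -/
theorem map_aeval_pSeries (M L : ℕ) :
    PowerSeries.map (MvPolynomial.aeval (sVar M L) :
      MvPolynomial ℕ ℚ →ₐ[ℚ] MvPolynomial (Fin L) (CoeffRing M)).toRingHom pSeries =
      (polyS M L : (MvPolynomial (Fin L) (CoeffRing M))⟦X⟧) := by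
  ext1 n
  rw [PowerSeries.coeff_map, Polynomial.coeff_coe, coeff_polyS, pSeries, PowerSeries.coeff_mk]
  simp

theorem coeff_polyS_pow (M L N k : ℕ) :
    coeff N ((polyS M L : (MvPolynomial (Fin L) (CoeffRing M))⟦X⟧) ^ k) =
      ∑ ν : Nat.Partition N, algebraMap ℚ (MvPolynomial (Fin L) (CoeffRing M))
        (MvPolynomial.coeff (Multiset.toFinsupp ν.parts) (coeff N (pSeries ^ k))) *
          (ν.parts.map (sVar M L)).prod := by
  rw [← map_aeval_pSeries, ← map_pow, PowerSeries.coeff_map]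
  exact aeval_eq_sum_partition (sVar M L) fun d hd =>
    ⟨(coeff_pSeries_pow_ne_zero k N d hd).1, (coeff_pSeries_pow_ne_zero k N d hd).2.1⟩

theorem powerSumS_eq (M L : ℕ) {N : ℕ} (ν : Nat.Partition N) :
    powerSumS M L ν = algebraMap ℚ (MvPolynomial (Fin L) (CoeffRing M)) (ν.parts.prod : ℚ) *
      (ν.parts.map (sVar M L)).prod := by
  rw [powerSumS, Multiset.prod_map_mul, map_natCast, Nat.cast_multiset_prod]

/-- The genus zero one-point coefficients are the Lagrange inversion coefficients. -/
theorem sum_connectedHurwitz_mul_powerSumS (M L : ℕ) {N : ℕ} (hN : N ≠ 0) :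
    (N : MvPolynomial (Fin L) (CoeffRing M)) * ∑ ν : Nat.Partition N, MvPolynomial.C
        (connectedHurwitz M (ν.parts.card - 1) (Nat.Partition.indiscrete N) ν) * powerSumS M L ν =
      ∑ k ∈ Finset.range N, algebraMap ℚ _ ((k : ℚ) + 1)⁻¹ *
        (((weightG M).map (algebraMap (CoeffRing M) (MvPolynomial (Fin L) (CoeffRing M)))) ^ N).coeff
          k * coeff N ((polyS M L : (MvPolynomial (Fin L) (CoeffRing M))⟦X⟧) ^ (k + 1)) := by
  simp only [coeff_polyS_pow, Finset.mul_sum]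
  rw [Finset.sum_comm]
  refine Finset.sum_congr rfl fun ν _ => ?_
  obtain ⟨k, hk⟩ := exists_card_parts_eq_succ hN ν
  have hkN : k < N := by
    have h := Multiset.card_nsmul_le_sum (s := ν.parts) (a := 1) fun x hx => ν.parts_pos hx
    rw [ν.parts_sum, hk] at h
    simpa using h
  have hprod : (ν.parts.prod : ℚ) ≠ 0 := by
    rw [Nat.cast_ne_zero]
    exact Multiset.prod_ne_zero fun h0 => (ν.parts_pos h0).ne' rfl
  have hN' : (N : ℚ) ≠ 0 := Nat.cast_ne_zero.mpr hN
  -- A partition with `k + 1` parts occurs only in `P ^ (k + 1)`.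
  rw [Finset.sum_eq_single k]
  · rw [hk, Nat.add_sub_cancel, connectedHurwitz_indiscrete M hN ν hk, powerSumS_eq,
      ← Polynomial.map_pow, Polynomial.coeff_map, ← MvPolynomial.algebraMap_eq, smul_smul,
      Algebra.smul_def, map_mul, ← IsScalarTower.algebraMap_apply, ← map_natCast (algebraMap ℚ _) N]
    set c := MvPolynomial.coeff (Multiset.toFinsupp ν.parts) (coeff N (pSeries ^ (k + 1)))
    have h : algebraMap ℚ (MvPolynomial (Fin L) (CoeffRing M)) (N : ℚ) *
        algebraMap ℚ _ (((N : ℚ) * (ν.parts.prod : ℚ))⁻¹ * (((k : ℚ) + 1)⁻¹ * c)) *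
        algebraMap ℚ _ (ν.parts.prod : ℚ) = algebraMap ℚ _ ((k : ℚ) + 1)⁻¹ * algebraMap ℚ _ c := by
      rw [← map_mul, ← map_mul, ← map_mul]
      congr 1
      field_simp
    linear_combination (algebraMap (CoeffRing M) (MvPolynomial (Fin L) (CoeffRing M))
      ((weightG M ^ N).coeff k) * (ν.parts.map (sVar M L)).prod) * h
  · intro j _ hj
    rw [show MvPolynomial.coeff (Multiset.toFinsupp ν.parts) (coeff N (pSeries ^ (j + 1))) = 0 from
      ?_, map_zero, zero_mul, mul_zero]
    by_contra hne
    have h := (coeff_pSeries_pow_ne_zero _ _ _ hne).2.2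
    rw [degree_toFinsupp, hk] at h
    omega
  · intro h
    exact absurd (Finset.mem_range.mpr hkN) h

/-! ### From the one-variable equation to the curve, by scaling -/

/-- The substitution `γ ↦ γ x`. -/
def scaleHom (B : Type*) [CommRing B] : B⟦X⟧ →+* B[X]⟦X⟧ :=
  (PowerSeries.rescale (Polynomial.X : B[X])).comp (PowerSeries.map Polynomial.C)

theorem scaleHom_X (B : Type*) [CommRing B] :
    scaleHom B X = X * PowerSeries.C (Polynomial.X : B[X]) := by
  rw [scaleHom, RingHom.comp_apply, PowerSeries.map_X, PowerSeries.rescale_X, mul_comm]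

theorem scaleHom_C {B : Type*} [CommRing B] (a : B) :
    scaleHom B (PowerSeries.C a) = PowerSeries.C (Polynomial.C a) := by
  ext1 n
  rw [scaleHom, RingHom.comp_apply, PowerSeries.coeff_rescale, PowerSeries.coeff_map,
    PowerSeries.coeff_C, PowerSeries.coeff_C]
  split_ifs with h
  · simp [h]
  · simp

theorem scaleHom_aeval {B : Type*} [CommRing B] (f : B⟦X⟧) (P : B[X]) :
    scaleHom B (Polynomial.aeval f P) = Polynomial.aeval (scaleHom B f) P := by
  have h : (scaleHom B).comp (algebraMap B B⟦X⟧) = algebraMap B B[X]⟦X⟧ := by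
    refine RingHom.ext fun a => ?_
    rw [RingHom.comp_apply, PowerSeries.algebraMap_apply, PowerSeries.algebraMap_apply,
      Algebra.algebraMap_self, RingHom.id_apply, Polynomial.algebraMap_eq, scaleHom_C]
  rw [Polynomial.aeval_def, Polynomial.hom_eval₂, h, Polynomial.aeval_def]

theorem C_X_mul_left_cancel {B : Type*} [CommRing B] {y y' : B[X]⟦X⟧}
    (h : PowerSeries.C (Polynomial.X : B[X]) * y = PowerSeries.C (Polynomial.X : B[X]) * y') :
    y = y' := by
  ext1 n
  have hn := congrArg (coeff n) h
  rw [PowerSeries.coeff_C_mul, PowerSeries.coeff_C_mul] at hn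
  exact Polynomial.isRegular_X.left hn

/-- `F01` depends on `γ` and `x` only through `γ x`, and `x ∂/∂x` multiplies its `N`-th term by `N`,
the factor needed to match the Lagrange coefficients. -/
theorem xVar_mul_W01 (M L : ℕ) {u : (MvPolynomial (Fin L) (CoeffRing M))⟦X⟧}
    (hu0 : constantCoeff u = 0) (hu : ∀ n ≠ 0, coeff n u = ∑ k ∈ Finset.range n,
      algebraMap ℚ _ ((k : ℚ) + 1)⁻¹ *
        (((weightG M).map (algebraMap (CoeffRing M) (MvPolynomial (Fin L) (CoeffRing M)))) ^ n).coeff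
          k * coeff n ((polyS M L : (MvPolynomial (Fin L) (CoeffRing M))⟦X⟧) ^ (k + 1))) :
    xVar M L * W01 M L = scaleHom _ u := by
  ext1 n
  rw [xVar, PowerSeries.coeff_C_mul, W01, PowerSeries.coeff_mk, F01, PowerSeries.coeff_mk,
    scaleHom, RingHom.comp_apply, PowerSeries.coeff_rescale, PowerSeries.coeff_map]
  rcases Nat.eq_zero_or_pos n with rfl | hn
  · rw [PowerSeries.coeff_zero_eq_constantCoeff_apply, hu0]
    simp
  · obtain ⟨m, rfl⟩ := Nat.exists_eq_succ_of_ne_zero hn.ne'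
    rw [if_neg hn.ne', hu _ hn.ne', ← sum_connectedHurwitz_mul_powerSumS M L hn.ne',
      ← Finset.sum_mul, ← map_sum, Polynomial.derivative_C_mul_X_pow, map_mul]
    simp only [Nat.succ_eq_add_one, Nat.add_sub_cancel, map_mul, map_natCast]
    ring

/-- Base change of `G` to `𝐊[𝐬]`, so that `G` and `S` have the same coefficient ring, as Lagrange
inversion requires. -/
theorem isSpectralCurveSolution_iff (M L : ℕ) (y : (CurveRing M L)⟦X⟧) :
    IsSpectralCurveSolution M L y ↔ xVar M L * y =
      Polynomial.aeval (gammaVar M L * xVar M L * Polynomial.aeval (xVar M L * y)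
        ((weightG M).map (algebraMap (CoeffRing M) (MvPolynomial (Fin L) (CoeffRing M)))))
        (polyS M L) := by
  rw [IsSpectralCurveSolution, Polynomial.aeval_map_algebraMap]

theorem isSpectralCurveSolution_unique (M L : ℕ) {y y' : (CurveRing M L)⟦X⟧}
    (hy : IsSpectralCurveSolution M L y) (hy' : IsSpectralCurveSolution M L y') : y = y' := by
  simp only [IsSpectralCurveSolution, Polynomial.aeval_def, Polynomial.eval₂_eq_eval_map] at hy hy'
  -- The fixed point is `x y`, with `f = γ x` divisible by `γ`; afterwards `x` is cancelled as a
  -- regular element.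
  exact C_X_mul_left_cancel (fixedPoint_unique _ _ (Dvd.intro _ rfl) hy hy')

end SpectralCurveEquation

end SpectralCurve

end

theorem mainTheorem8 (M L : ℕ) :
    SpectralCurve.W01 M L ∈ Ideal.span {SpectralCurve.gammaVar M L} ∧
    SpectralCurve.IsSpectralCurveSolution M L (SpectralCurve.W01 M L) ∧
    ∀ y : PowerSeries (SpectralCurve.CurveRing M L),
      y ∈ Ideal.span {SpectralCurve.gammaVar M L} →
      SpectralCurve.IsSpectralCurveSolution M L y →
      y = SpectralCurve.W01 M L := by
  open SpectralCurve in
  have hW : IsSpectralCurveSolution M L (W01 M L) := by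
    obtain ⟨u, hu, hu0, hc⟩ := exists_fixedPoint_coeff (polyS M L)
      ((weightG M).map (algebraMap (CoeffRing M) (MvPolynomial (Fin L) (CoeffRing M))))
      (by rw [coeff_polyS]; simp)
      (by rw [Polynomial.coeff_map, weightG]; simp [Polynomial.coeff_X_pow])
    rw [isSpectralCurveSolution_iff, xVar_mul_W01 M L hu0 hc]
    -- Applying the substitution `γ ↦ γ x` to `u = S(γ G(u))` gives the curve equation for `x y`.
    conv_lhs => rw [hu]
    rw [scaleHom_aeval, map_mul, scaleHom_X, scaleHom_aeval]
    rfl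
  refine ⟨?_, hW, fun y _ hy => SpectralCurve.isSpectralCurveSolution_unique M L hy hW⟩
  -- Divisibility by `γ` holds because the `N = 0` term of `F01` is zero by definition.
  rw [Ideal.mem_span_singleton, SpectralCurve.gammaVar, PowerSeries.X_dvd_iff,
    ← PowerSeries.coeff_zero_eq_constantCoeff_apply, SpectralCurve.W01, PowerSeries.coeff_mk,
    SpectralCurve.F01, PowerSeries.coeff_mk, if_pos rfl, Polynomial.derivative_zero]
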